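/- For a Coxeter matrix $M=(m_{ij})_{i,j\in I}$ let $\mathrm{Br}^+(M)$ (resp. $\mathrm{Br}(M)$) be the Artin monoid (resp. group) with generators $T_i$, $i\in I$, and relations $T_iT_jT_i\cdots=T_jT_iT_j\cdots$ ($m_{ij}$ factors on each side, $i\ne j$, $m_{ij}<\infty$), and let $W(M)$ be the Coxeter group with simple reflections $s_i$. For $w\in W(M)$, $T_w\in\mathrm{Br}^+(M)$ is the unique square free lift of $w$, i.e. the element of length $\ell(w)$ with image $w$; $w_\circ^K$ is the longest element of $W_K=\langle s_k:k\in K\rangle$ if this group is finite ($K$ is then said to be of finite type). For $K$ of finite type let $\mathsf P(\mathrm{Br}^+_K(M))$ be the submonoid generated by all $T_{w_\circ^{K'}w_\circ^{C}}$, where $C$ is a connected component of $K$ and $K'\subset C$. For $x\in\mathrm{Br}^+(M)$ let $\operatorname{supp}x$ be the smallest $K\subset I$ such that $x$ lies in the submonoid generated by the $T_k$, $k\in K$. A homomorphism $\Phi:\mathrm{Br}^+(M')\to\mathrm{Br}^+(M)$ with $M'=(m'_{ij})_{i,j\in I'}$, where $T'_i$ are the generators of $\mathrm{Br}^+(M')$,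 is called - *optimal* if, for all $i,j\in I'$ with $\Phi(T'_i)\neq\Phi(T'_j)$ such that the set of $k\ge1$ for which the alternating products $\Phi(T'_i)\Phi(T'_j)\Phi(T'_i)\cdots$ and $\Phi(T'_j)\Phi(T'_i)\Phi(T'_j)\cdots$ with $k$ factors coincide is non-empty, $m'_{ij}$ is the minimum of that set; - *parabolic* if $\Phi(\mathsf P(\mathrm{Br}^+_K(M')))\subset\mathsf P(\mathrm{Br}^+_{[\Phi](K)}(M))$ for every maximal $K\subset I'$ of finite type, where $[\Phi](K)=\bigcup_{k\in K}\operatorname{supp}\Phi(T'_k)$; - *of Coxeter type* if it induces a homomorphism of groups $W(M')\to W(M)$. Identify $W(A_n)$ with $S_{n+1}$ via $s_k\mapsto(k,k+1)$, and for $1\le i<j\le n+1$ let $T_{(i,j)}\in\mathrm{Br}^+(A_n)$ be the square free lift of the transposition $(i,j)$. For $J=\{j_1<\dots<j_p\}\subset[1,n+1]$ and $k\in\{0,1\}$ put $$\tilde\tau_k(J)=\prod_{1\le r<p,\ r\equiv k\,(2)}T_{(j_r,j_{r+1})},\qquad T_J=\tilde\tau_1(J)\,\tilde\tau_0(J)$$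 (the factors of each $\tilde\tau_k(J)$ commute). **Proposition.** Let $1\le a<b\le n$ and $J=[1,a]\cup[b+1,n+1]$. Put $m=|J|/2$ if $J=\{n+2-j: j\in J\}$, and $m=|J|$ otherwise. Let $I_2(2m)$ be the rank $2$ Coxeter matrix with off-diagonal entry $2m$. Then the assignments $T'_1\mapsto\tilde\tau_1(J)$, $T'_2\mapsto\tilde\tau_0(J)$ define an optimal parabolic Coxeter type homomorphism $\mathrm{Br}^+(I_2(2m))\to\mathrm{Br}^+(A_n)$. Moreover, in the Artin group $\mathrm{Br}(A_n)$, $$T_J^{|J|}=T_{w_\circ^{[1,n]}}^{2}\,T_{w_\circ^{[a+1,b-1]}}^{-2}.$$ -/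

import Mathlib

namespace ArtinHom

noncomputable section

/-! Coxeter matrices are Mathlib's `CoxeterMatrix`, in which the entry `0` stands for `∞`. -/

/-- The alternating product `x y x y ⋯` with `m` factors. -/
def brd {N : Type*} [Monoid N] (x y : N) (m : ℕ) : N := (x * y) ^ (m / 2) * x ^ (m % 2)

theorem map_brd {N N' : Type*} [Monoid N] [Monoid N'] (f : N →* N') (x y : N) (m : ℕ) :
    f (brd x y m) = brd (f x) (f y) m := by
  simp [brd]

/-- The set of all `k > 0` such that the two alternating products with `k` factors agree. -/
def braidSet {N : Type*} [Monoid N] (x y : N) : Set ℕ := {k | 0 < k ∧ brd x y k = brd y x k}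

section General

variable {B : Type*} (M : CoxeterMatrix B)

/-- The braid relations `T_i T_j T_i ⋯ = T_j T_i T_j ⋯` (`M i j` factors on each side) for `i ≠ j`
with `M i j` finite. -/
def artinRel (x y : FreeMonoid B) : Prop :=
  ∃ i j : B, i ≠ j ∧ M i j ≠ 0 ∧
    x = brd (FreeMonoid.of i) (FreeMonoid.of j) (M i j) ∧
    y = brd (FreeMonoid.of j) (FreeMonoid.of i) (M i j)

/-- The Artin monoid of a Coxeter matrix. -/
abbrev ArtinMonoid : Type _ := PresentedMonoid (artinRel M)

/-- The standard generators `T_i` of the Artin monoid. -/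
def T (i : B) : ArtinMonoid M := PresentedMonoid.of (artinRel M) i

/-- The Artin group of a Coxeter matrix: same generators and relations as the Artin monoid. -/
abbrev ArtinGroup : Type _ :=
  PresentedGroup {r : FreeGroup B | ∃ i j : B, i ≠ j ∧ M i j ≠ 0 ∧
    r = brd (FreeGroup.of i) (FreeGroup.of j) (M i j) *
      (brd (FreeGroup.of j) (FreeGroup.of i) (M i j))⁻¹}

/-- The canonical homomorphism from the Artin monoid to the Artin group. -/
def toGroup : ArtinMonoid M →* ArtinGroup M :=
  PresentedMonoid.lift (fun i => PresentedGroup.of i) (by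
    rintro _ _ ⟨i, j, hij, h0, rfl, rfl⟩
    rw [map_brd, map_brd]
    simp only [FreeMonoid.lift_eval_of]
    rw [← mul_inv_eq_one]
    have h := PresentedGroup.one_of_mem
      (rels := {r : FreeGroup B | ∃ i j : B, i ≠ j ∧ M i j ≠ 0 ∧
        r = brd (FreeGroup.of i) (FreeGroup.of j) (M i j) *
          (brd (FreeGroup.of j) (FreeGroup.of i) (M i j))⁻¹}) ⟨i, j, hij, h0, rfl⟩
    rw [map_mul, map_inv, map_brd, map_brd] at h
    exact h)

/-- The length homomorphism from the Artin monoid to `(ℕ, +)`, sending every `T_i` to `1`. -/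
def lengthHom : ArtinMonoid M →* Multiplicative ℕ :=
  PresentedMonoid.lift (fun _ => Multiplicative.ofAdd 1) (by
    rintro _ _ ⟨i, j, hij, h0, rfl, rfl⟩
    simp [brd])

/-- The length of an element of the Artin monoid. -/
def len (x : ArtinMonoid M) : ℕ := Multiplicative.toAdd (lengthHom M x)

theorem brd_simple (i j : B) :
    brd (M.simple i) (M.simple j) (M i j) = brd (M.simple j) (M.simple i) (M i j) := by
  have hi : M.simple i * M.simple i = 1 := M.toCoxeterSystem.simple_mul_simple_self i
  have hj : M.simple j * M.simple j = 1 := M.toCoxeterSystem.simple_mul_simple_self j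
  have hp : (M.simple i * M.simple j) ^ M i j = 1 := M.toCoxeterSystem.simple_mul_simple_pow i j
  generalize M.simple i = x at *
  generalize M.simple j = y at *
  have hinv : y * x = (x * y)⁻¹ := by
    rw [mul_inv_rev, inv_eq_of_mul_eq_one_right hi, inv_eq_of_mul_eq_one_right hj]
  unfold brd
  rw [hinv, inv_pow, eq_inv_mul_iff_mul_eq, ← mul_assoc, ← pow_add]
  rcases Nat.mod_two_eq_zero_or_one (M i j) with h | h
  · rw [h, pow_zero, pow_zero, mul_one, ← hp]
    congr 1
    omega
  · rw [h, pow_one, pow_one]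
    have h2 : (x * y) ^ (M i j / 2 + M i j / 2) * x * y = 1 := by
      rw [mul_assoc, ← pow_succ, ← hp]
      congr 1
      omega
    rw [eq_inv_of_mul_eq_one_left h2, inv_eq_of_mul_eq_one_right hj]

/-- The canonical homomorphism from the Artin monoid to the Coxeter group, `T_i ↦ s_i`. -/
def toCoxeter : ArtinMonoid M →* M.Group :=
  PresentedMonoid.lift (fun i => M.simple i) (by
    rintro _ _ ⟨i, j, hij, h0, rfl, rfl⟩
    rw [map_brd, map_brd]
    simpa only [FreeMonoid.lift_eval_of] using brd_simple M i j)

/-- The length function of the Coxeter group. -/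
def coxLen (w : M.Group) : ℕ := M.toCoxeterSystem.length w

/-- An element of the Artin monoid is square free if its image in the Coxeter group has the
same length. -/
def IsSquareFree (x : ArtinMonoid M) : Prop := coxLen M (toCoxeter M x) = len M x

theorem exists_squareFree (w : M.Group) : ∃ x, IsSquareFree M x ∧ toCoxeter M x = w := by
  obtain ⟨ω, hω, rfl⟩ := M.toCoxeterSystem.exists_isReduced w
  have h1 : ∀ l : List B, toCoxeter M ((l.map (T M)).prod) = M.toCoxeterSystem.wordProd l := by
    intro l
    rw [map_list_prod, List.map_map]
    rfl
  have h2 : ∀ l : List B, len M ((l.map (T M)).prod) = l.length := by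
    intro l
    induction l with
    | nil => simp [len]
    | cons a l ih =>
      rw [List.map_cons, List.prod_cons, List.length_cons, ← ih, len, len, map_mul, toAdd_mul,
        add_comm]
      rfl
  refine ⟨(ω.map (T M)).prod, ?_, h1 ω⟩
  rw [IsSquareFree, h1, h2]
  exact hω

/-- `T_w`: the square free element of the Artin monoid that maps to `w` (there is only one). -/
def sqfLift (w : M.Group) : ArtinMonoid M := (exists_squareFree M w).choose

/-- The parabolic subgroup `W_J` of the Coxeter group. -/
def parabolicSubgroup (J : Set B) : Subgroup M.Group := Subgroup.closure (M.simple '' J)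

/-- `J` is of finite type if `W_J` is finite. -/
def IsFiniteType (J : Set B) : Prop := (parabolicSubgroup M J : Set M.Group).Finite

open Classical in
/-- The element of maximal length in `W_J` for `J` of finite type (in that case it exists and is
unique; the value `1` in the other case is never used). -/
def longest (J : Set B) : M.Group :=
  if h : ∃ w ∈ parabolicSubgroup M J, ∀ u ∈ parabolicSubgroup M J, coxLen M u ≤ coxLen M w
  then h.choose else 1

/-- The Coxeter graph (without labels): `i` and `j` are joined if `i ≠ j` and `m_{ij} ≠ 2`. -/
def coxeterGraph : SimpleGraph B where
  Adj i j := i ≠ j ∧ M i j ≠ 2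
  symm := ⟨fun i j h => ⟨h.1.symm, by rw [M.symmetric]; exact h.2⟩⟩
  loopless := ⟨fun _ h => h.1 rfl⟩

/-- `C` is a connected component of the full subgraph of the Coxeter graph on `K`. -/
def IsComponent (K C : Set B) : Prop :=
  ∃ c : ((coxeterGraph M).induce K).ConnectedComponent, C = Subtype.val '' c.supp

/-- For `K` of finite type, the submonoid of the Artin monoid generated by the parabolic elements
`T_{w_{J;C}}`, `w_{J;C} = w_∘^J w_∘^C`, where `C` runs over the connected components of `K` and `J`
over the subsets of `C`. -/
def parabolicElements (K : Set B) : Submonoid (ArtinMonoid M) :=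
  Submonoid.closure
    {x | ∃ C J : Set B, IsComponent M K C ∧ J ⊆ C ∧ x = sqfLift M (longest M J * longest M C)}

/-- The parabolic submonoid of the Artin monoid, generated by the `T_j` with `j ∈ J`. -/
def parabolicSubmonoid (J : Set B) : Submonoid (ArtinMonoid M) := Submonoid.closure (T M '' J)

/-- The support of an element of the Artin monoid. -/
def supp (x : ArtinMonoid M) : Set B := ⋂ J ∈ {J : Set B | x ∈ parabolicSubmonoid M J}, J

end General

section Homs

variable {B' B : Type*} {M' : CoxeterMatrix B'} {M : CoxeterMatrix B}

/-- The union of the supports of the images of the `T_j`, `j ∈ J`. -/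
def suppMap (Φ : ArtinMonoid M' →* ArtinMonoid M) (J : Set B') : Set B :=
  ⋃ j ∈ J, supp M (Φ (T M' j))

/-- A homomorphism of Artin monoids is optimal if `m'_{ij} = min B(Φ(T_i), Φ(T_j))` whenever
`Φ(T_i) ≠ Φ(T_j)` and `B(Φ(T_i), Φ(T_j))` is non-empty. -/
def IsOptimal (Φ : ArtinMonoid M' →* ArtinMonoid M) : Prop :=
  ∀ i j : B', Φ (T M' i) ≠ Φ (T M' j) → (braidSet (Φ (T M' i)) (Φ (T M' j))).Nonempty →
    IsLeast (braidSet (Φ (T M' i)) (Φ (T M' j))) (M' i j)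

/-- A homomorphism of Artin monoids is of Coxeter type if it induces a homomorphism of the
Coxeter groups. -/
def IsCoxeterType (Φ : ArtinMonoid M' →* ArtinMonoid M) : Prop :=
  ∃ f : M'.Group →* M.Group, ∀ x, f (toCoxeter M' x) = toCoxeter M (Φ x)

/-- A homomorphism of Artin monoids is parabolic if, for every maximal subset `J` of finite type,
it maps the monoid of parabolic elements for `J` to the one for `[Φ](J)`. -/
def IsParabolic (Φ : ArtinMonoid M' →* ArtinMonoid M) : Prop :=
  ∀ J : Set B', Maximal (IsFiniteType M') J →
    (parabolicElements M' J).map Φ ≤ parabolicElements M (suppMap Φ J)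

end Homs

/-- The Coxeter matrix of type `I₂(k)`, `k ≥ 2`, with off-diagonal entry `k` (Mathlib's
`CoxeterMatrix.I m` has off-diagonal entry `m + 2`). -/
def dihedral (k : ℕ) : CoxeterMatrix (Fin 2) := CoxeterMatrix.I (k - 2)

/-! In type `A_n` the index `k ∈ [1,n]` corresponds to `k - 1 : Fin n`. -/

/-- The simple reflection `s_k = (k, k+1)` of `W(A_n) = S_{n+1}` for `k ∈ [1,n]`. -/
def simpleA (n k : ℕ) : (CoxeterMatrix.A n).Group :=
  if h : 1 ≤ k ∧ k ≤ n then (CoxeterMatrix.A n).simple ⟨k - 1, by omega⟩ else 1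

/-- The transposition `(i, j) = s_i ⋯ s_{j-2} s_{j-1} s_{j-2} ⋯ s_i` in `W(A_n) = S_{n+1}` for
`1 ≤ i < j ≤ n + 1`. -/
def transposition (n i j : ℕ) : (CoxeterMatrix.A n).Group :=
  ((List.Ico i (j - 1)).map (simpleA n)).prod * simpleA n (j - 1) *
    ((List.Ico i (j - 1)).map (simpleA n)).prod⁻¹

/-- `T_{(i,j)}`: the square free lift of the transposition `(i, j)`, with the convention that
`T_{(i,j)} = 1` if `i ≥ j`. -/
def liftTransposition (n i j : ℕ) : ArtinMonoid (CoxeterMatrix.A n) :=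
  if i < j then sqfLift (CoxeterMatrix.A n) (transposition n i j) else 1

/-- For `J = {j_1 < ⋯ < j_m}`, the product of the (commuting) `T_{(j_r, j_{r+1})}` with
`1 ≤ r < m` and `r ≡ k` modulo `2`; here `j_r` is `Nat.nth (· ∈ J) (r - 1)`. -/
def tauTilde (n : ℕ) (J : Finset ℕ) (k : ℕ) : ArtinMonoid (CoxeterMatrix.A n) :=
  (((List.Ico 1 J.card).filter (fun r => r % 2 = k)).map
    (fun r => liftTransposition n (Nat.nth (· ∈ J) (r - 1)) (Nat.nth (· ∈ J) r))).prod

/-- `T_J`. -/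
def TJ (n : ℕ) (J : Finset ℕ) : ArtinMonoid (CoxeterMatrix.A n) :=
  tauTilde n J 1 * tauTilde n J 0

/-- `T_{w_∘^{[i,j]}}` in type `A_n`; it is `1` if the interval is empty. -/
def liftLongestInterval (n i j : ℕ) : ArtinMonoid (CoxeterMatrix.A n) :=
  sqfLift (CoxeterMatrix.A n)
    (longest (CoxeterMatrix.A n) {k : Fin n | i ≤ (k : ℕ) + 1 ∧ (k : ℕ) + 1 ≤ j})

/-- The subset `[1,a] ∪ [b+1,n+1]` of `[1,n+1]`. -/
def gapSet (n a b : ℕ) : Finset ℕ := Finset.Icc 1 a ∪ Finset.Icc (b + 1) (n + 1)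

/-- `m(J)`: half of `|J|` if `J ⊆ [1,n+1]` is stable under `j ↦ n + 2 - j`, and `|J|` otherwise. -/
def mOf (n : ℕ) (J : Finset ℕ) : ℕ :=
  if J.image (fun j => n + 2 - j) = J then J.card / 2 else J.card

end

end ArtinHom

/-!
Write `n = s + h + r + 2`, `a = s + 1`, `b = s + h + 2`, and number the strands from `0` to `n`. The set
`J` then consists of the first `s + 1` and the last `r + 1` strands; the strands in between form the gap.
Let `Δ` be the half twist on all strands, `G` the half twist on the gap, `x_0, x_1, …` the lifts of the
transpositions of neighbouring elements of `J` (`gapGen`), and `A`, `B` the products of the `x_i` with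
`i` even and odd (`altProd`), so that `T_J = A B`.

*The full rotation.* The product `A B` is conjugate, by cyclic shifts, to `x_0 x_1 ⋯`
(`exists_semiconj_bipartite`), and a power of `σ_0 σ_1 ⋯ σ_{n-1}` conjugates the latter to the rotation
`eps` of `|J|` strands around a bundle which carries the gap. Adding one strand at a time gives the
`|J|`-th power of `eps`, and the result is `G² (A B)^|J| = Δ²` in the Artin monoid
(`halfTwist_sq_mul_bipartite_pow`). As `Δ²` is central and the `x_i` commute with `G`, cancellation
gives `(A B)^|J| = (B A)^|J|`. Cancellation rests on Garside's lemma (`garside`), which also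
shows that `Δ` is the least common multiple of the generators (`halfTwist_dvd`).

*The symmetric case.* If `s = r`, both `G (A B)^(s + 1)` and `Δ` have the same length and the same
permutation, which is computed by unfolding the motion of a strand bouncing between the two ends
(`perm_bipartite_pow`). Square free elements are determined by their permutations
(`IsRed.eq_of_perm_eq`, a consequence of the exchange property `IsRed.dvd`), so the two agree.

*Optimality.* If an alternating product `z` of `k > 0` factors does not depend on the first factor, it is
divisible by all `x_i`; hence `Δ` divides `G z`, and comparing lengths gives `k ≥ |J|`. If `s ≠ r`, then
`|J| < k < 2|J|` is impossible since `2|J| - k` would be another such number, and `k = |J|` would give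
`G z = Δ`, although `G z` preserves the gap and `Δ` does not (`isLeast_braidSet`).

*Parabolicity.* A square free element that lies in the submonoid generated by its left divisors among the
generators lifts a longest element (`longest_eq`). This applies to the half twists and to `G A` and `G B`,
all of which divide `Δ`; their complements in `Δ` are therefore parabolic. The images of the
relevant elements of the dihedral monoid, namely the alternating products of length `2m` and `2m - 1`
(`len_parabolic`), are products of at most two such complements (`brd_mem_parabolicElements`).
-/

namespace ArtinHom

/-! ### Generators, length and relations in the Artin monoid of type `A` -/

/-- The positive braid monoid on the strands `0, …, n`. -/
abbrev Br (n : ℕ) : Type := ArtinMonoid (CoxeterMatrix.A n)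

/-- Generators joined by an edge of the Coxeter graph of type `A`. -/
def Near {n : ℕ} (i j : Fin n) : Prop := (i : ℕ) + 1 = j ∨ (j : ℕ) + 1 = i

/-- Distinct generators that are not joined by an edge. -/
def Far {n : ℕ} (i j : Fin n) : Prop := (i : ℕ) + 1 < j ∨ (j : ℕ) + 1 < i

theorem Near.symm {n : ℕ} {i j : Fin n} (h : Near i j) : Near j i := Or.symm h

theorem Far.symm {n : ℕ} {i j : Fin n} (h : Far i j) : Far j i := Or.symm h

theorem eq_or_near_or_far {n : ℕ} (i j : Fin n) : i = j ∨ Near i j ∨ Far i j := by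
  unfold Near Far
  rw [Fin.ext_iff]
  omega

section General

variable {B : Type*} (M : CoxeterMatrix B)

theorem brd_T (i j : B) (hij : i ≠ j) (h0 : M i j ≠ 0) :
    brd (T M i) (T M j) (M i j) = brd (T M j) (T M i) (M i j) := by
  have h : PresentedMonoid.mk (artinRel M)
      (brd (FreeMonoid.of i) (FreeMonoid.of j) (M i j)) = PresentedMonoid.mk (artinRel M)
      (brd (FreeMonoid.of j) (FreeMonoid.of i) (M i j)) :=
    PresentedMonoid.mk_eq_mk_of_rel ⟨i, j, hij, h0, rfl, rfl⟩
  rwa [map_brd, map_brd] at h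

@[simp] theorem toCoxeter_T (i : B) : toCoxeter M (T M i) = M.simple i := rfl

@[simp] theorem len_one : len M 1 = 0 := by simp [len]

@[simp] theorem len_mul (x y : ArtinMonoid M) : len M (x * y) = len M x + len M y := by
  simp [len]

@[simp] theorem len_T (i : B) : len M (T M i) = 1 := rfl

theorem len_pow (x : ArtinMonoid M) (k : ℕ) : len M (x ^ k) = k * len M x := by
  induction k with
  | zero => simp
  | succ k ih => rw [pow_succ, len_mul, ih]; ring

theorem artin_induction {p : ArtinMonoid M → Prop} (one : p 1)
    (mul : ∀ i x, p x → p (T M i * x)) (x : ArtinMonoid M) : p x := by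
  induction x using PresentedMonoid.inductionOn with
  | h w =>
    induction w using FreeMonoid.inductionOn' with
    | one => simpa using one
    | of_mul a w ih => rw [map_mul]; exact mul a _ ih

theorem eq_one_or_eq_T_mul (x : ArtinMonoid M) : x = 1 ∨ ∃ i y, x = T M i * y := by
  induction x using artin_induction with
  | one => exact Or.inl rfl
  | mul i x _ => exact Or.inr ⟨i, x, rfl⟩

theorem eq_one_of_len_eq_zero {x : ArtinMonoid M} (h : len M x = 0) : x = 1 := by
  rcases eq_one_or_eq_T_mul M x with h1 | ⟨i, y, rfl⟩
  · exact h1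
  · simp at h

end General

section TypeA

variable {n : ℕ}

local notation "τ" => T (CoxeterMatrix.A n)
local notation "ℓ" => len (CoxeterMatrix.A n)

theorem A_near {i j : Fin n} (h : Near i j) : CoxeterMatrix.A n i j = 3 := by
  have h1 : i ≠ j := by rintro rfl; unfold Near at h; omega
  have h2 : (j : ℕ) + 1 = i ∨ (i : ℕ) + 1 = j := h.symm
  change (if i = j then 1 else (if (j : ℕ) + 1 = i ∨ (i : ℕ) + 1 = j then 3 else 2)) = 3
  rw [if_neg h1, if_pos h2]

theorem A_far {i j : Fin n} (h : Far i j) : CoxeterMatrix.A n i j = 2 := by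
  have h1 : i ≠ j := by rintro rfl; unfold Far at h; omega
  have h2 : ¬ ((j : ℕ) + 1 = i ∨ (i : ℕ) + 1 = j) := by unfold Far at h; omega
  change (if i = j then 1 else (if (j : ℕ) + 1 = i ∨ (i : ℕ) + 1 = j then 3 else 2)) = 2
  rw [if_neg h1, if_neg h2]

theorem T_braid {i j : Fin n} (h : Near i j) : τ i * (τ j * τ i) = τ j * (τ i * τ j) := by
  have h1 : i ≠ j := by rintro rfl; unfold Near at h; omega
  have := brd_T (CoxeterMatrix.A n) i j h1 (by rw [A_near h]; norm_num)
  rw [A_near h] at this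
  simpa [brd, mul_assoc] using this

theorem T_comm {i j : Fin n} (h : Far i j) : τ i * τ j = τ j * τ i := by
  have h1 : i ≠ j := by rintro rfl; unfold Far at h; omega
  have := brd_T (CoxeterMatrix.A n) i j h1 (by rw [A_far h]; norm_num)
  rw [A_far h] at this
  simpa [brd] using this

theorem T_braid_mul {i j : Fin n} (h : Near i j) (z : Br n) :
    τ i * (τ j * (τ i * z)) = τ j * (τ i * (τ j * z)) := by
  have := congrArg (· * z) (T_braid h)
  simpa only [mul_assoc] using this

theorem T_comm_mul {i j : Fin n} (h : Far i j) (z : Br n) :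
    τ i * (τ j * z) = τ j * (τ i * z) := by
  rw [← mul_assoc, T_comm h, mul_assoc]

/-- The universal property of the positive braid monoid. -/
theorem exists_hom {N : Type*} [Monoid N] (f : Fin n → N)
    (hb : ∀ i j, Near i j → f i * (f j * f i) = f j * (f i * f j))
    (hc : ∀ i j, Far i j → f i * f j = f j * f i) :
    ∃ φ : Br n →* N, ∀ i, φ (τ i) = f i := by
  refine ⟨PresentedMonoid.lift f ?_, fun i => rfl⟩
  rintro _ _ ⟨i, j, hij, h0, rfl, rfl⟩
  rw [map_brd, map_brd]
  simp only [FreeMonoid.lift_eval_of]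
  rcases eq_or_near_or_far i j with h | h | h
  · exact absurd h hij
  · rw [A_near h]; simpa [brd, mul_assoc] using hb i j h
  · rw [A_far h]; simpa [brd] using hc i j h

/-! ### Garside's lemma and cancellation -/

/-- The conclusion of Garside's lemma for an equation `T_i x = T_j y`: the equation is a
consequence of the least common right multiple of `T_i` and `T_j`. -/
def GarsideComp (i j : Fin n) (x y : Br n) : Prop :=
  (i = j → x = y) ∧ (Near i j → ∃ z, x = τ j * (τ i * z) ∧ y = τ i * (τ j * z)) ∧
    (Far i j → ∃ z, x = τ j * z ∧ y = τ i * z)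

theorem not_near_self (i : Fin n) : ¬ Near i i := by unfold Near; omega

theorem not_far_self (i : Fin n) : ¬ Far i i := by unfold Far; omega

theorem not_near_of_far {i j : Fin n} (h : Far i j) : ¬ Near i j := by
  unfold Near Far at *; omega

theorem GarsideComp.of_eq (i : Fin n) (x : Br n) : GarsideComp i i x x :=
  ⟨fun _ => rfl, fun h => absurd h (not_near_self i), fun h => absurd h (not_far_self i)⟩

theorem GarsideComp.of_near {i j : Fin n} (h : Near i j) (z : Br n) {x y : Br n}
    (hx : x = τ j * (τ i * z)) (hy : y = τ i * (τ j * z)) : GarsideComp i j x y :=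
  ⟨fun e => absurd (e ▸ h) (not_near_self _), fun _ => ⟨z, hx, hy⟩,
    fun h' => absurd h (not_near_of_far h')⟩

theorem GarsideComp.of_far {i j : Fin n} (h : Far i j) (z : Br n) {x y : Br n}
    (hx : x = τ j * z) (hy : y = τ i * z) : GarsideComp i j x y :=
  ⟨fun e => absurd (e ▸ h) (not_far_self _), fun h' => absurd h' (not_near_of_far h),
    fun _ => ⟨z, hx, hy⟩⟩

theorem GarsideComp.symm {i j : Fin n} {x y : Br n} (h : GarsideComp i j x y) :
    GarsideComp j i y x := by
  refine ⟨fun e => (h.1 e.symm).symm, fun e => ?_, fun e => ?_⟩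
  · obtain ⟨z, h1, h2⟩ := h.2.1 e.symm
    exact ⟨z, h2, h1⟩
  · obtain ⟨z, h1, h2⟩ := h.2.2 e.symm
    exact ⟨z, h2, h1⟩

theorem GarsideComp.mul_right {i j : Fin n} {x y : Br n} (h : GarsideComp i j x y) (w : Br n) :
    GarsideComp i j (x * w) (y * w) := by
  refine ⟨fun e => by rw [h.1 e], fun e => ?_, fun e => ?_⟩
  · obtain ⟨z, rfl, rfl⟩ := h.2.1 e
    exact ⟨z * w, by simp only [mul_assoc], by simp only [mul_assoc]⟩
  · obtain ⟨z, rfl, rfl⟩ := h.2.2 e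
    exact ⟨z * w, by simp only [mul_assoc], by simp only [mul_assoc]⟩

/-- Transitivity in the induction for Garside's lemma: given the lemma for shorter elements, two
consecutive equations `T_i x = T_k z = T_j y` can be composed. This is where the rank three
subsystems `A₁ × A₁ × A₁`, `A₁ × A₂` and `A₃` enter. -/
theorem GarsideComp.trans {L : ℕ}
    (H : ∀ (i j : Fin n) (x y : Br n), ℓ x < L → τ i * x = τ j * y → GarsideComp i j x y)
    {i k j : Fin n} {x z y : Br n} (hz : ℓ z ≤ L) (h1 : GarsideComp i k x z)
    (h2 : GarsideComp k j z y) : GarsideComp i j x y := by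
  -- `k` near to `i` and far from `j`; the mirror image follows by symmetry.
  have mixed : ∀ {i k j : Fin n} {x z y : Br n}, ℓ z ≤ L → Near i k → Far k j →
      GarsideComp i k x z → GarsideComp k j z y → GarsideComp i j x y := by
    intro i k j x z y hz hik hkj h1 h2
    obtain ⟨u, rfl, rfl⟩ := h1.2.1 hik
    obtain ⟨v, hv, rfl⟩ := h2.2.2 hkj
    simp only [len_mul, len_T] at hz
    have lv := congrArg ℓ hv
    simp only [len_mul, len_T] at lv
    rcases eq_or_near_or_far i j with e | e | e
    · exact absurd hkj (by subst e; exact fun h => not_near_of_far h hik.symm)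
    · obtain ⟨w, hw1, rfl⟩ := (H i j _ v (by simp; omega) hv).2.1 e
      have lw := congrArg ℓ hw1
      simp only [len_mul, len_T] at lw
      obtain ⟨w', rfl, hw3⟩ := (H k j u (τ i * w) (by omega) hw1).2.2 hkj
      obtain ⟨q, rfl, rfl⟩ := (H i k w w' (by omega) hw3).2.1 hik
      refine GarsideComp.of_near e (τ k * (τ i * (τ j * q))) ?_ ?_
      · rw [T_braid_mul e, T_comm_mul hkj, T_comm_mul hkj.symm q, T_braid_mul hik.symm]
      · rw [T_comm_mul hkj.symm, T_braid_mul hik.symm, T_braid_mul e, T_comm_mul hkj]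
    · obtain ⟨w, hw1, rfl⟩ := (H i j _ v (by simp; omega) hv).2.2 e
      have lw := congrArg ℓ hw1
      simp only [len_mul, len_T] at lw
      obtain ⟨w', rfl, rfl⟩ := (H k j u w (by omega) hw1).2.2 hkj
      refine GarsideComp.of_far e (τ k * (τ i * w')) ?_ ?_
      · rw [T_comm_mul e, T_comm_mul hkj]
      · rw [T_braid_mul hik.symm]
  rcases eq_or_near_or_far i k with rfl | hik | hik
  · rwa [h1.1 rfl]
  · rcases eq_or_near_or_far k j with rfl | hkj | hkj
    · rwa [← h2.1 rfl]
    · obtain ⟨u, rfl, rfl⟩ := h1.2.1 hik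
      obtain ⟨v, hv, rfl⟩ := h2.2.1 hkj
      simp only [len_mul, len_T] at hz
      have lv := congrArg ℓ hv
      simp only [len_mul, len_T] at lv
      rcases eq_or_near_or_far i j with rfl | e | e
      · have h3 := (H i i _ _ (by simp; omega) hv).1 rfl
        rw [(H k k u v (by omega) h3).1 rfl]
        exact GarsideComp.of_eq _ _
      · exfalso
        unfold Near at hik hkj e
        omega
      · obtain ⟨w, hw1, hw2⟩ := (H i j _ _ (by simp; omega) hv).2.2 e
        have lw := congrArg ℓ hw1
        simp only [len_mul, len_T] at lw
        obtain ⟨p, rfl, rfl⟩ := (H k j u w (by omega) hw1).2.1 hkj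
        obtain ⟨q, rfl, hq⟩ := (H k i v _ (by omega) hw2).2.1 hik.symm
        simp only [len_mul, len_T] at hz lv lw
        have h3 := (H k k _ _ (by simp; omega) hq).1 rfl
        obtain ⟨r, rfl, rfl⟩ := (H j i p q (by omega) h3).2.2 e.symm
        refine GarsideComp.of_far e (τ k * (τ j * (τ i * (τ k * r)))) ?_ ?_
        · rw [T_comm_mul e, T_braid_mul hik, T_braid_mul hkj]
        · rw [T_comm_mul e.symm (τ k * (τ j * r)), T_braid_mul hkj.symm, T_braid_mul hik.symm,
            T_comm_mul e]
    · exact mixed hz hik hkj h1 h2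
  · rcases eq_or_near_or_far k j with rfl | hkj | hkj
    · rwa [← h2.1 rfl]
    · exact (mixed hz hkj.symm hik.symm h2.symm h1.symm).symm
    · obtain ⟨u, rfl, rfl⟩ := h1.2.2 hik
      obtain ⟨v, hv, rfl⟩ := h2.2.2 hkj
      simp only [len_mul, len_T] at hz
      have lv := congrArg ℓ hv
      simp only [len_mul, len_T] at lv
      rcases eq_or_near_or_far i j with rfl | e | e
      · rw [(H i i u v (by omega) hv).1 rfl]
        exact GarsideComp.of_eq _ _
      · obtain ⟨w, rfl, rfl⟩ := (H i j u v (by omega) hv).2.1 e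
        refine GarsideComp.of_near e (τ k * w) ?_ ?_
        · rw [T_comm_mul hkj, T_comm_mul hik.symm]
        · rw [T_comm_mul hik.symm, T_comm_mul hkj]
      · obtain ⟨w, rfl, rfl⟩ := (H i j u v (by omega) hv).2.2 e
        exact GarsideComp.of_far e (τ k * w) (T_comm_mul hkj w) (T_comm_mul hik.symm w)

/-- Garside's lemma on words, by induction on the chain of braid moves. -/
theorem garside_words {L : ℕ}
    (H : ∀ (i j : Fin n) (x y : Br n), ℓ x < L → τ i * x = τ j * y → GarsideComp i j x y)
    {v w : FreeMonoid (Fin n)} (h : conGen (artinRel (CoxeterMatrix.A n)) v w) :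
    ℓ (PresentedMonoid.mk _ v) ≤ L + 1 →
    (v = 1 ∧ w = 1) ∨ ∃ i v' j w', v = FreeMonoid.of i * v' ∧ w = FreeMonoid.of j * w' ∧
      GarsideComp i j (PresentedMonoid.mk _ v') (PresentedMonoid.mk _ w') := by
  have h' : ConGen.Rel (artinRel (CoxeterMatrix.A n)) v w := h
  clear h
  induction h' with
  | of x y hxy =>
    intro _
    right
    obtain ⟨i, j, hij, -, rfl, rfl⟩ := hxy
    rcases eq_or_near_or_far i j with e | e | e
    · exact absurd e hij
    · rw [A_near e]
      refine ⟨i, FreeMonoid.of j * FreeMonoid.of i, j, FreeMonoid.of i * FreeMonoid.of j,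
        by simp [brd, mul_assoc], by simp [brd, mul_assoc], ?_⟩
      exact GarsideComp.of_near e 1 (by rw [mul_one]; rfl) (by rw [mul_one]; rfl)
    · rw [A_far e]
      refine ⟨i, FreeMonoid.of j, j, FreeMonoid.of i, by simp [brd], by simp [brd], ?_⟩
      exact GarsideComp.of_far e 1 (by rw [mul_one]; rfl) (by rw [mul_one]; rfl)
  | refl x =>
    intro _
    induction x using FreeMonoid.inductionOn' with
    | one => exact Or.inl ⟨rfl, rfl⟩
    | of_mul i x _ => exact Or.inr ⟨i, x, i, x, rfl, rfl, GarsideComp.of_eq _ _⟩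
  | @symm x y hxy ih =>
    intro hl
    have hmk : PresentedMonoid.mk (artinRel (CoxeterMatrix.A n)) x = PresentedMonoid.mk _ y :=
      PresentedMonoid.mk_eq_mk_iff.2 hxy
    rcases ih (by rw [hmk]; exact hl) with ⟨rfl, rfl⟩ | ⟨i, v', j, w', h1, h2, h3⟩
    · exact Or.inl ⟨rfl, rfl⟩
    · exact Or.inr ⟨j, w', i, v', h2, h1, h3.symm⟩
  | @trans x y z hxy hyz ih1 ih2 =>
    intro hl
    have hmk : PresentedMonoid.mk (artinRel (CoxeterMatrix.A n)) x = PresentedMonoid.mk _ y :=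
      PresentedMonoid.mk_eq_mk_iff.2 hxy
    have hl' := hl
    rw [hmk] at hl'
    rcases ih1 hl with ⟨rfl, rfl⟩ | ⟨i, v', k, u', h1, h2, h3⟩
    · rcases ih2 hl' with ⟨-, rfl⟩ | ⟨k, u', j, w', h1, -, -⟩
      · exact Or.inl ⟨rfl, rfl⟩
      · exact absurd (congrArg FreeMonoid.length h1) (by simp; omega)
    · rcases ih2 hl' with ⟨rfl, rfl⟩ | ⟨k', u'', j, w', h4, h5, h6⟩
      · exact absurd (congrArg FreeMonoid.length h2) (by simp; omega)
      · have hcons : k :: u'.toList = k' :: u''.toList := h2.symm.trans h4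
        obtain ⟨rfl, hu⟩ := List.cons.inj hcons
        obtain rfl : u' = u'' := hu
        refine Or.inr ⟨i, v', j, w', h1, h5, GarsideComp.trans H ?_ h3 h6⟩
        have hlen : ℓ (PresentedMonoid.mk _ y) = ℓ (PresentedMonoid.mk _ u') + 1 := by
          rw [h2, map_mul, len_mul, add_comm]; rfl
        omega
  | @mul w x y z hwx hyz ih1 ih2 =>
    intro hl
    rw [map_mul, len_mul] at hl
    rcases ih1 (by omega) with ⟨rfl, rfl⟩ | ⟨i, v', j, w', rfl, rfl, h3⟩
    · simpa only [one_mul] using ih2 (by omega)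
    · refine Or.inr ⟨i, v' * y, j, w' * z, mul_assoc _ _ _, mul_assoc _ _ _, ?_⟩
      have hmk : PresentedMonoid.mk (artinRel (CoxeterMatrix.A n)) y = PresentedMonoid.mk _ z :=
        PresentedMonoid.mk_eq_mk_iff.2 hyz
      rw [map_mul, map_mul, hmk]
      exact h3.mul_right _

/-- Garside's lemma: two generators dividing an element on the left have a least common multiple
dividing it. -/
theorem garside (i j : Fin n) (x y : Br n) (h : τ i * x = τ j * y) : GarsideComp i j x y := by
  obtain ⟨L, hL⟩ : ∃ L, ℓ x ≤ L := ⟨_, le_rfl⟩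
  induction L using Nat.strong_induction_on generalizing i j x y with
  | _ L ih =>
    obtain ⟨v, rfl⟩ := PresentedMonoid.surjective_mk x
    obtain ⟨w, rfl⟩ := PresentedMonoid.surjective_mk y
    have h' : PresentedMonoid.mk (artinRel (CoxeterMatrix.A n)) (FreeMonoid.of i * v) =
        PresentedMonoid.mk _ (FreeMonoid.of j * w) := by
      rw [map_mul, map_mul]; exact h
    have hl : ℓ (PresentedMonoid.mk _ (FreeMonoid.of i * v)) ≤ L + 1 := by
      rw [map_mul, len_mul, add_comm]
      exact Nat.succ_le_succ hL
    rcases garside_words (L := L) (fun i j x y hx hxy => ih _ hx i j x y hxy le_rfl)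
      (PresentedMonoid.mk_eq_mk_iff.1 h') hl with ⟨h1, -⟩ | ⟨i', v', j', w', h1, h2, h3⟩
    · exact absurd (congrArg FreeMonoid.length h1) (by simp)
    · have e1 : i :: v.toList = i' :: v'.toList := h1
      have e2 : j :: w.toList = j' :: w'.toList := h2
      obtain ⟨rfl, hu⟩ := List.cons.inj e1
      obtain rfl : v = v' := hu
      obtain ⟨rfl, hu⟩ := List.cons.inj e2
      obtain rfl : w = w' := hu
      exact h3

theorem br_mul_left_cancel {x y z : Br n} (h : x * y = x * z) : y = z := by
  induction x using artin_induction with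
  | one => simpa using h
  | mul i x ih =>
    rw [mul_assoc, mul_assoc] at h
    exact ih ((garside i i _ _ h).1 rfl)

/-- The anti-automorphism reversing words. -/
theorem exists_reverse : ∃ φ : Br n →* (Br n)ᵐᵒᵖ, ∀ i, φ (τ i) = MulOpposite.op (τ i) := by
  refine exists_hom _ (fun i j h => ?_) (fun i j h => ?_)
  · simp only [← MulOpposite.op_mul, mul_assoc, T_braid h]
  · simp only [← MulOpposite.op_mul, T_comm h]

theorem br_mul_right_cancel {x y z : Br n} (h : y * x = z * x) : y = z := by
  obtain ⟨φ, hφ⟩ := exists_reverse (n := n)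
  have inv : ∀ w, (φ (φ w).unop).unop = w := by
    intro w
    induction w using artin_induction with
    | one => simp
    | mul i w ih => simp [hφ, ih]
  have h' := congrArg (fun w => (φ w).unop) h
  simp only [map_mul, MulOpposite.unop_mul] at h'
  have := congrArg (fun w => (φ w).unop) (br_mul_left_cancel h')
  simpa only [inv] using this

end TypeA

/-! ### Half twists -/

section HalfTwists

variable {n : ℕ}

/-- The generator of the positive braid monoid exchanging the strands `k` and `k + 1`, with the
value `1` for `k ≥ n`. -/
noncomputable def gen (n k : ℕ) : Br n := if h : k < n then T (CoxeterMatrix.A n) ⟨k, h⟩ else 1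

/-- The ascending product of the `k` generators with indices `s, …, s + k - 1`. -/
noncomputable def up (n s : ℕ) : ℕ → Br n
  | 0 => 1
  | k + 1 => up n s k * gen n (s + k)

/-- The descending product of the `k` generators with indices `s, …, s + k - 1`. -/
noncomputable def dn (n s : ℕ) : ℕ → Br n
  | 0 => 1
  | k + 1 => gen n (s + k) * dn n s k

/-- The positive half twist on the strands `s, …, s + k`. -/
noncomputable def halfTwist (n s : ℕ) : ℕ → Br n
  | 0 => 1
  | k + 1 => halfTwist n s k * dn n s (k + 1)

local notation "τ" => T (CoxeterMatrix.A n)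
local notation "ℓ" => len (CoxeterMatrix.A n)
local notation "σ" => gen n

theorem gen_of_lt {k : ℕ} (h : k < n) : σ k = τ ⟨k, h⟩ := dif_pos h

@[simp] theorem gen_val (i : Fin n) : σ i = τ i := gen_of_lt i.2

theorem len_gen {k : ℕ} (h : k < n) : ℓ (σ k) = 1 := by rw [gen_of_lt h, len_T]

theorem gen_comm {i j : ℕ} (h : i + 1 < j) : σ i * σ j = σ j * σ i := by
  unfold gen
  split_ifs with h1 h2
  · exact T_comm (Or.inl h)
  all_goals simp

theorem gen_commute {i j : ℕ} (h : i + 1 < j ∨ j + 1 < i) : Commute (σ i) (σ j) := by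
  rcases h with h | h
  · exact gen_comm h
  · exact (gen_comm h).symm

theorem gen_braid {i : ℕ} (h : i + 1 < n) :
    σ i * (σ (i + 1) * σ i) = σ (i + 1) * (σ i * σ (i + 1)) := by
  rw [gen_of_lt h, gen_of_lt (Nat.lt_of_succ_lt h)]
  exact T_braid (Or.inl rfl)

theorem garside_far {i j : ℕ} (hi : i < n) (hj : j < n) (h : i + 1 < j ∨ j + 1 < i) {x y : Br n}
    (e : σ i * x = σ j * y) : ∃ z, x = σ j * z ∧ y = σ i * z := by
  rw [gen_of_lt hi, gen_of_lt hj] at *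
  exact (garside _ _ _ _ e).2.2 h

theorem garside_near {i : ℕ} (hi : i + 1 < n) {x y : Br n}
    (e : σ (i + 1) * x = σ i * y) :
    ∃ z, x = σ i * (σ (i + 1) * z) ∧ y = σ (i + 1) * (σ i * z) := by
  rw [gen_of_lt hi, gen_of_lt (Nat.lt_of_succ_lt hi)] at *
  exact (garside _ _ _ _ e).2.1 (Or.inr rfl)

/-- The submonoid generated by the `k` generators with indices `s, …, s + k - 1`. -/
noncomputable def segMonoid (n s k : ℕ) : Submonoid (Br n) :=
  Submonoid.closure (gen n '' Set.Ico s (s + k))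

theorem gen_mem_segMonoid {s k i : ℕ} (h1 : s ≤ i) (h2 : i < s + k) : σ i ∈ segMonoid n s k :=
  Submonoid.subset_closure ⟨i, ⟨h1, h2⟩, rfl⟩

theorem segMonoid_mono {s k s' k' : ℕ} (h1 : s' ≤ s) (h2 : s + k ≤ s' + k') :
    segMonoid n s k ≤ segMonoid n s' k' := by
  refine Submonoid.closure_mono (Set.image_mono fun i hi => ?_)
  simp only [Set.mem_Ico] at *
  omega

theorem up_mem (s k : ℕ) : up n s k ∈ segMonoid n s k := by
  induction k with
  | zero => exact one_mem _
  | succ k ih =>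
    exact mul_mem (segMonoid_mono le_rfl (by omega) ih) (gen_mem_segMonoid (by omega) (by omega))

theorem dn_mem (s k : ℕ) : dn n s k ∈ segMonoid n s k := by
  induction k with
  | zero => exact one_mem _
  | succ k ih =>
    exact mul_mem (gen_mem_segMonoid (by omega) (by omega)) (segMonoid_mono le_rfl (by omega) ih)

theorem halfTwist_mem (s k : ℕ) : halfTwist n s k ∈ segMonoid n s k := by
  induction k with
  | zero => exact one_mem _
  | succ k ih => exact mul_mem (segMonoid_mono le_rfl (by omega) ih) (dn_mem _ _)

theorem commute_of_mem_segMonoid {s k : ℕ} {x y : Br n} (hx : x ∈ segMonoid n s k)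
    (h : ∀ i, s ≤ i → i < s + k → Commute y (σ i)) : Commute y x := by
  induction hx using Submonoid.closure_induction with
  | mem x hx =>
    obtain ⟨i, ⟨h1, h2⟩, rfl⟩ := hx
    exact h i h1 h2
  | one => exact Commute.one_right _
  | mul x z _ _ hx hz => exact hx.mul_right hz

theorem gen_commute_seg {s k j : ℕ} {x : Br n} (hx : x ∈ segMonoid n s k)
    (h : s + k + 1 ≤ j ∨ j + 2 ≤ s) : Commute (σ j) x :=
  commute_of_mem_segMonoid hx fun i hi1 hi2 => gen_commute (by omega)

theorem up_succ' (s k : ℕ) : up n s (k + 1) = σ s * up n (s + 1) k := by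
  induction k with
  | zero => simp [up]
  | succ k ih =>
    rw [up, ih, up, mul_assoc]
    congr 3
    omega

theorem dn_succ' (s k : ℕ) : dn n s (k + 1) = dn n (s + 1) k * σ s := by
  induction k with
  | zero => simp [dn]
  | succ k ih =>
    rw [dn, ih, dn, mul_assoc, show s + 1 + k = s + (k + 1) by omega]

theorem up_add (s k l : ℕ) : up n s (k + l) = up n s k * up n (s + k) l := by
  induction l with
  | zero => simp [up]
  | succ l ih => rw [← add_assoc, up, ih, up, mul_assoc, add_assoc]

theorem dn_add (s k l : ℕ) : dn n s (k + l) = dn n (s + k) l * dn n s k := by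
  induction l with
  | zero => simp [dn]
  | succ l ih => rw [← add_assoc, dn, ih, dn, mul_assoc, add_assoc]

/-- Conjugation by an ascending product raises indices by one. -/
theorem up_mul_gen {s k i : ℕ} (h1 : s ≤ i) (h2 : i + 1 < s + k) (h3 : s + k ≤ n) :
    up n s k * σ i = σ (i + 1) * up n s k := by
  induction k with
  | zero => omega
  | succ k ih =>
    rcases Nat.lt_or_ge (i + 1) (s + k) with h | h
    · rw [up, mul_assoc, ← gen_comm (i := i) (j := s + k) h, ← mul_assoc, ih h (by omega),
        mul_assoc]
    · obtain rfl : k = i + 1 - s := by omega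
      have e1 : i + 1 - s = (i - s) + 1 := by omega
      have e2 : s + (i - s) = i := by omega
      have e3 : s + (i - s + 1) = i + 1 := by omega
      have hc := (gen_commute_seg (n := n) (j := i + 1) (up_mem s (i - s)) (by omega)).eq
      rw [e1, up, up, e2, e3, mul_assoc, mul_assoc, gen_braid (by omega), ← mul_assoc, ← hc]
      simp only [mul_assoc]

theorem dn_mul_gen {s k i : ℕ} (h1 : s ≤ i) (h2 : i + 1 < s + k) (h3 : s + k ≤ n) :
    dn n s k * σ (i + 1) = σ i * dn n s k := by
  induction k with
  | zero => omega
  | succ k ih =>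
    rcases Nat.lt_or_ge (i + 1) (s + k) with h | h
    · rw [dn, mul_assoc, ih h (by omega), ← mul_assoc, ← gen_comm (i := i) (j := s + k) h,
        mul_assoc]
    · obtain rfl : k = i + 1 - s := by omega
      have e1 : i + 1 - s = (i - s) + 1 := by omega
      have e2 : s + (i - s) = i := by omega
      have e3 : s + (i - s + 1) = i + 1 := by omega
      have hc := (gen_commute_seg (n := n) (j := i + 1) (dn_mem s (i - s)) (by omega)).eq
      rw [e1, dn, dn, e2, e3, mul_assoc, mul_assoc, ← hc, ← mul_assoc (σ i),
        ← mul_assoc (σ (i + 1)), ← gen_braid (by omega)]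
      simp only [mul_assoc]

theorem halfTwist_succ_up (s k : ℕ) :
    halfTwist n s (k + 1) = up n s (k + 1) * halfTwist n s k := by
  induction k with
  | zero => simp [halfTwist, up, dn]
  | succ k ih =>
    have hc := (gen_commute_seg (n := n) (j := s + (k + 1)) (halfTwist_mem s k) (by omega)).eq
    rw [halfTwist, ih, dn, mul_assoc, ← mul_assoc (halfTwist n s k), ← hc, mul_assoc,
      ← halfTwist, ← mul_assoc, ← up, ih]

/-- Conjugation by the half twist reflects the indices. -/
theorem gen_mul_halfTwist {s k i : ℕ} (h : i < k) (h3 : s + k ≤ n) :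
    σ (s + i) * halfTwist n s k = halfTwist n s k * σ (s + (k - 1 - i)) := by
  induction k generalizing i with
  | zero => omega
  | succ k ih =>
    rcases Nat.lt_or_ge i k with h1 | h1
    · have h2 := dn_mul_gen (n := n) (s := s) (k := k + 1) (i := s + (k - 1 - i)) (by omega)
        (by omega) h3
      have e : s + (k - 1 - i) + 1 = s + (k + 1 - 1 - i) := by omega
      rw [halfTwist, ← mul_assoc, ih h1 (by omega), mul_assoc, ← h2, e, mul_assoc]
    · obtain rfl : i = k := by omega
      rcases Nat.eq_zero_or_pos i with rfl | h2
      · simp [halfTwist, dn]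
      · obtain ⟨j, rfl⟩ : ∃ j, i = j + 1 := ⟨i - 1, by omega⟩
        have h4 := up_mul_gen (n := n) (s := s) (k := j + 1 + 1) (i := s + j) (by omega) (by omega)
          h3
        rw [halfTwist_succ_up, ← mul_assoc, ← add_assoc s j 1, ← h4, mul_assoc,
          ih (Nat.lt_succ_self j) (by omega), mul_assoc]
        congr 4
        omega

/-- If conjugation by `x` raises the indices of the letters by one, it shifts descending products. -/
theorem dn_shift {x : Br n} {s k : ℕ} (h : ∀ i, s ≤ i → i < s + k → x * σ i = σ (i + 1) * x) :
    x * dn n s k = dn n (s + 1) k * x := by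
  induction k with
  | zero => simp [dn]
  | succ k ih =>
    rw [dn, ← mul_assoc, h _ (by omega) (by omega), mul_assoc,
      ih fun i h1 h2 => h i h1 (by omega), ← mul_assoc, dn]
    congr 3
    omega

theorem halfTwist_shift {x : Br n} {s k : ℕ}
    (h : ∀ i, s ≤ i → i < s + k → x * σ i = σ (i + 1) * x) :
    x * halfTwist n s k = halfTwist n (s + 1) k * x := by
  induction k with
  | zero => simp [halfTwist]
  | succ k ih =>
    rw [halfTwist, ← mul_assoc, ih fun i h1 h2 => h i h1 (by omega), mul_assoc, dn_shift h,
      ← mul_assoc, halfTwist]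

theorem halfTwist_succ_right {s k : ℕ} (h3 : s + k < n) :
    halfTwist n s (k + 1) = halfTwist n (s + 1) k * up n s (k + 1) := by
  rw [halfTwist_succ_up]
  exact halfTwist_shift fun i h1 h2 => up_mul_gen h1 (by omega) (by omega)

theorem dn_mul_up_commute {s k : ℕ} (h3 : s + k < n) {x : Br n} (hx : x ∈ segMonoid n s k) :
    Commute (dn n s (k + 1) * up n s (k + 1)) x := by
  refine commute_of_mem_segMonoid hx fun i hi1 hi2 => ?_
  rw [commute_iff_eq, mul_assoc, up_mul_gen hi1 (by omega) (by omega), ← mul_assoc,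
    dn_mul_gen hi1 (by omega) (by omega), mul_assoc]

theorem halfTwist_sq_succ {s k : ℕ} (h3 : s + k < n) :
    halfTwist n s (k + 1) ^ 2 = halfTwist n s k ^ 2 * (dn n s (k + 1) * up n s (k + 1)) := by
  rw [sq, sq]
  nth_rewrite 2 [halfTwist_succ_up]
  rw [halfTwist, mul_assoc, ← mul_assoc (dn n s (k + 1)),
    (dn_mul_up_commute h3 (halfTwist_mem s k)).eq, mul_assoc]

/-! ### Divisibility by half twists -/

/-- A generator dividing `h q` on the left divides `q` if it is far from all letters of `h`. -/
theorem gen_dvd_of_dvd_mul {i : ℕ} (hi : i < n) {F : Set ℕ}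
    (hF : ∀ j ∈ F, j < n ∧ (i + 1 < j ∨ j + 1 < i)) {h q : Br n}
    (hh : h ∈ Submonoid.closure (gen n '' F)) (hd : σ i ∣ h * q) : σ i ∣ q := by
  induction hh using Submonoid.closure_induction generalizing q with
  | mem x hx =>
    obtain ⟨j, hj, rfl⟩ := hx
    obtain ⟨y, hy⟩ := hd
    obtain ⟨z, hz, -⟩ := garside_far (hF j hj).1 hi (hF j hj).2.symm hy
    exact ⟨z, hz⟩
  | one => simpa using hd
  | mul x y _ _ hx hy => exact hy (hx (by rwa [mul_assoc] at hd))

theorem gen_dvd_of_dvd_seg_mul {i s k : ℕ} (hi : i < n) (hs : s + k ≤ n)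
    (hF : s + k + 1 ≤ i ∨ i + 2 ≤ s) {h q : Br n}
    (hh : h ∈ segMonoid n s k) (hd : σ i ∣ h * q) : σ i ∣ q := by
  refine gen_dvd_of_dvd_mul hi (fun j hj => ?_) hh hd
  simp only [Set.mem_Ico] at hj
  omega

/-- Pushing a divisor through a descending product: if the next higher generator divides the product,
it contributes a longer descending product. -/
theorem dn_dvd {s k : ℕ} (h3 : s + k < n) {y : Br n} (h : σ (s + k) ∣ dn n s k * y) :
    dn n s (k + 1) ∣ y := by
  induction k generalizing y with
  | zero => simpa [dn] using h
  | succ k ih =>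
    obtain ⟨z, hz⟩ := h
    rw [dn, mul_assoc] at hz
    obtain ⟨w, hw, -⟩ := garside_near (i := s + k) h3 hz.symm |>.imp fun _ => And.symm
    obtain ⟨y1, rfl⟩ : σ (s + k + 1) ∣ y :=
      gen_dvd_of_dvd_seg_mul h3 (by omega) (by omega) (dn_mem s k) ⟨_, hw⟩
    have hc := (gen_commute_seg (n := n) (j := s + k + 1) (dn_mem s k) (by omega)).eq
    rw [← mul_assoc, ← hc, mul_assoc] at hw
    obtain ⟨y2, rfl⟩ := ih (by omega) ⟨_, br_mul_left_cancel hw⟩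
    rw [← mul_assoc]
    exact ⟨y2, rfl⟩

/-- The half twist is the least common right multiple of its generators. -/
theorem halfTwist_dvd {s k : ℕ} (h3 : s + k ≤ n) {x : Br n}
    (h : ∀ i, s ≤ i → i < s + k → σ i ∣ x) : halfTwist n s k ∣ x := by
  induction k with
  | zero => simp [halfTwist]
  | succ k ih =>
    obtain ⟨y, rfl⟩ := ih (by omega) fun i h1 h2 => h i h1 (by omega)
    refine mul_dvd_mul_left _ (dn_dvd (by omega) ?_)
    have hk := h (s + k) (by omega) (by omega)
    rcases Nat.eq_zero_or_pos k with rfl | hk0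
    · simpa [dn, halfTwist] using hk
    · obtain ⟨j, rfl⟩ : ∃ j, k = j + 1 := ⟨k - 1, by omega⟩
      rw [halfTwist, mul_assoc] at hk
      exact gen_dvd_of_dvd_seg_mul (by omega) (by omega) (by omega) (halfTwist_mem s j) hk

theorem gen_dvd_halfTwist {s k i : ℕ} (h1 : s ≤ i) (h2 : i < s + k) (h3 : s + k ≤ n) :
    σ i ∣ halfTwist n s k := by
  induction k generalizing i with
  | zero => omega
  | succ k ih =>
    rcases Nat.lt_or_ge i (s + k) with h | h
    · rw [halfTwist]
      exact Dvd.dvd.mul_right (ih h1 h (by omega)) _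
    · obtain rfl : i = s + k := by omega
      rw [halfTwist_succ_up]
      rcases Nat.eq_zero_or_pos k with rfl | hk
      · simp [up]
      · obtain ⟨j, rfl⟩ : ∃ j, k = j + 1 := ⟨k - 1, by omega⟩
        obtain ⟨y, hy⟩ := ih (i := s + j) (by omega) (by omega) (by omega)
        rw [hy, ← mul_assoc, up_mul_gen (by omega) (by omega) h3, mul_assoc]
        exact ⟨_, rfl⟩

end HalfTwists

/-! ### Coxeter elements on a path -/

section Path

variable {N : Type*} [Monoid N]

/-- The product of the `x r` with `r < m` and `r ≡ e` modulo `2`. -/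
def altProd (x : ℕ → N) (e : ℕ) : ℕ → N
  | 0 => 1
  | m + 1 => altProd x e m * (if m % 2 = e then x m else 1)

/-- The product `x 0 * ⋯ * x (m - 1)`. -/
def linProd (x : ℕ → N) : ℕ → N
  | 0 => 1
  | m + 1 => linProd x m * x m

theorem altProd_induction {P : N → Prop} (one : P 1) (mul : ∀ u v, P u → P v → P (u * v))
    {x : ℕ → N} {e m : ℕ} (h : ∀ i < m, i % 2 = e → P (x i)) : P (altProd x e m) := by
  induction m with
  | zero => exact one
  | succ m ih =>
    refine mul _ _ (ih fun i hi => h i (by omega)) ?_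
    split_ifs with hm
    · exact h m (by omega) hm
    · exact one

theorem commute_altProd {x : ℕ → N} {y : N} {e m : ℕ} (h : ∀ i < m, i % 2 = e → Commute y (x i)) :
    Commute y (altProd x e m) :=
  altProd_induction (Commute.one_right _) (fun _ _ h1 h2 => h1.mul_right h2) h

/-- In a monoid with elements `x 0, x 1, …` of which non-neighbours commute, the bipartite product
is conjugate to the linear one, by cyclic shifts. The extra factor `y` makes the induction work. -/
theorem exists_semiconj_bipartite {x : ℕ → N} (hx : ∀ i j, i + 1 < j → Commute (x i) (x j))
    (m : ℕ) (y : N) (hy : ∀ i, i + 1 < m → Commute y (x i)) :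
    ∃ Y, SemiconjBy Y (linProd x m * y) (altProd x 0 m * altProd x 1 m * y) ∧
      ∀ z, (∀ i < m, Commute z (x i)) → Commute z y → Commute z Y := by
  induction m generalizing y with
  | zero => exact ⟨1, by simp [linProd, altProd], fun z _ _ => Commute.one_right z⟩
  | succ m ih =>
    obtain ⟨Y, hY, hz⟩ := ih (x m * y) fun i hi =>
      (hx i m hi).symm.mul_left (hy i (by omega))
    have hl : linProd x (m + 1) * y = linProd x m * (x m * y) := by rw [linProd, mul_assoc]
    rcases Nat.mod_two_eq_zero_or_one m with h | h
    · refine ⟨x m * y * Y, ?_, fun z h1 h2 => ?_⟩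
      · rw [hl]
        refine SemiconjBy.mul_left ?_ hY
        have h0 : Commute (x m) (altProd x 0 m) :=
          commute_altProd fun i hi hi2 => (hx i m (by omega)).symm
        have h1 : Commute y (altProd x 0 m * altProd x 1 m) :=
          Commute.mul_right (commute_altProd fun i hi _ => hy i (by omega))
            (commute_altProd fun i hi _ => hy i (by omega))
        have e : altProd x 0 (m + 1) * altProd x 1 (m + 1) * y =
            x m * y * (altProd x 0 m * altProd x 1 m) := by
          simp only [altProd, h, if_true, zero_ne_one, if_false, mul_one]
          rw [← h0.eq, mul_assoc (x m), mul_assoc (x m), ← h1.eq, mul_assoc]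
        rw [e]
        simp only [SemiconjBy, mul_assoc]
      · have h3 := h1 m (by omega)
        exact (h3.mul_right h2).mul_right (hz z (fun i hi => h1 i (by omega)) (h3.mul_right h2))
    · refine ⟨Y, ?_, fun z h1 h2 => hz z (fun i hi => h1 i (by omega))
        ((h1 m (by omega)).mul_right h2)⟩
      have e : altProd x 0 (m + 1) * altProd x 1 (m + 1) * y =
          altProd x 0 m * altProd x 1 m * (x m * y) := by
        simp [altProd, h, mul_assoc]
      rw [hl, e]
      exact hY

end Path

/-! ### Coxeter-like elements with a gap -/

section Gap

variable {n : ℕ}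

local notation "σ" => gen n

/-- The positive lift of the transposition of the strands `s` and `s + g + 1`. -/
noncomputable def cross (n s g : ℕ) : Br n := up n s (g + 1) * dn n s g

theorem cross_mem (s g : ℕ) : cross n s g ∈ segMonoid n s (g + 1) :=
  mul_mem (up_mem _ _) (segMonoid_mono le_rfl (by omega) (dn_mem _ _))

/-- Multiplying the half twist on the strands strictly between `s` and `s + h + 2` with the lift of
the transposition of these two strands gives the half twist on all of them. -/
theorem halfTwist_mul_cross {s h : ℕ} (hn : s + h + 1 < n) :
    halfTwist n (s + 1) h * cross n s (h + 1) = halfTwist n s (h + 2) := by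
  rw [halfTwist, halfTwist_succ_right (by omega), dn, cross, up]
  simp only [mul_assoc]

theorem gen_commute_cross {s g i : ℕ} (hn : s + g < n) (h1 : s < i) (h2 : i < s + g) :
    Commute (σ i) (cross n s g) := by
  obtain ⟨j, rfl⟩ : ∃ j, i = j + 1 := ⟨i - 1, by omega⟩
  have e1 := up_mul_gen (n := n) (s := s) (k := g + 1) (i := j) (by omega) (by omega) (by omega)
  have e2 := dn_mul_gen (n := n) (s := s) (k := g) (i := j) (by omega) (by omega) (by omega)
  rw [commute_iff_eq, cross, ← mul_assoc, ← e1, mul_assoc, ← e2, mul_assoc]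

/-- The rotation of the strands `g, …, g + q` around the strands `0, …, g - 1`. -/
noncomputable def eps (n g q : ℕ) : Br n := dn n 0 g * up n 0 (g + q)

theorem eps_mul_gen {g q i : ℕ} (h1 : g ≤ i) (h2 : i + 1 < g + q) (h3 : g + q ≤ n) :
    eps n g q * σ i = σ (i + 1) * eps n g q := by
  have hc := (gen_commute_seg (n := n) (j := i + 1) (dn_mem 0 g) (by omega)).eq
  rw [eps, mul_assoc, up_mul_gen (by omega) (by omega) (by omega), ← mul_assoc, ← hc, mul_assoc]

theorem eps_succ (g q : ℕ) : eps n g (q + 1) = eps n g q * σ (g + q) := by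
  rw [eps, ← add_assoc, up, eps, mul_assoc, zero_add]

/-- Powers of the rotation of `q + 2` strands are compared with those of the rotation of the first
`q + 1` strands: the last strand contributes a descending product. -/
theorem eps_succ_pow {g q k : ℕ} (hk : k ≤ q + 1) (h3 : g + q < n) :
    eps n g (q + 1) ^ k = eps n g q ^ k * dn n (g + q + 1 - k) k := by
  induction k with
  | zero => simp [dn]
  | succ k ih =>
    have hs := dn_shift (x := eps n g (q + 1)) (s := g + q - k) (k := k)
      fun i h1 h2 => eps_mul_gen (by omega) (by omega) (by omega)
    have e1 : g + q - k + 1 = g + q + 1 - k := by omega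
    have e2 : g + q + 1 - (k + 1) = g + q - k := by omega
    have e3 : g + q - k + k = g + q := by omega
    rw [e1] at hs
    rw [pow_succ, ih (by omega), mul_assoc, ← hs, eps_succ, e2, dn, e3, pow_succ]
    simp only [mul_assoc]

/-- The full rotation of `q + 1` strands around a bundle of `h + 1` strands, multiplied with the
full twist of the bundle, is the full twist. -/
theorem halfTwist_sq_mul_eps_pow {h q : ℕ} (hn : h + 1 + q ≤ n) :
    halfTwist n 0 h ^ 2 * eps n (h + 1) q ^ (q + 1) = halfTwist n 0 (h + 1 + q) ^ 2 := by
  induction q with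
  | zero =>
    rw [zero_add, pow_one, add_zero, halfTwist_sq_succ (by omega), eps]
  | succ q ih =>
    have e : h + 1 + q + 1 - (q + 1) = h + 1 := by omega
    rw [pow_succ (eps _ _ _), eps_succ_pow le_rfl (by omega), e, ← mul_assoc, ← mul_assoc,
      ih (by omega), mul_assoc, eps, ← mul_assoc, ← add_assoc, halfTwist_sq_succ (by omega)]
    have e2 := dn_add (n := n) 0 (h + 1) (q + 1)
    rw [zero_add] at e2
    rw [add_assoc (h + 1) q 1, e2]
    simp only [mul_assoc]

/-- The full twist is central. -/
theorem commute_halfTwist_sq (x : Br n) : Commute (halfTwist n 0 n ^ 2) x := by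
  induction x using artin_induction with
  | one => exact Commute.one_right _
  | mul i x ih =>
    refine Commute.mul_right ?_ ih
    have h1 := gen_mul_halfTwist (n := n) (s := 0) (k := n) i.2 (by omega)
    have h2 := gen_mul_halfTwist (n := n) (s := 0) (k := n) (i := n - 1 - i) (by omega) (by omega)
    rw [show 0 + (n - 1 - (n - 1 - (i : ℕ))) = i by omega] at h2
    rw [zero_add] at h1 h2
    rw [zero_add] at h1
    rw [commute_iff_eq, ← gen_val, sq, mul_assoc, ← h2, ← mul_assoc, ← h1, mul_assoc]

/-- The generators attached to the points of the set `{0, …, s} ∪ {s + g + 1, …, n}`: the `r`-th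
one is the positive lift of the transposition of the `r`-th and the next point. -/
noncomputable def gapGen (n s g r : ℕ) : Br n :=
  if r < s then gen n r else if r = s then cross n s g else gen n (r + g)

theorem gapGen_of_lt {s g r : ℕ} (h : r < s) : gapGen n s g r = σ r := if_pos h

theorem gapGen_self {s g : ℕ} : gapGen n s g s = cross n s g := by simp [gapGen]

theorem gapGen_of_gt {s g r : ℕ} (h : s < r) : gapGen n s g r = σ (r + g) := by
  rw [gapGen, if_neg (by omega), if_neg (by omega)]

theorem gapGen_commute {s g i j : ℕ} (h : i + 1 < j) :
    Commute (gapGen n s g i) (gapGen n s g j) := by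
  rcases lt_trichotomy i s with hi | rfl | hi
  · rw [gapGen_of_lt hi]
    rcases lt_trichotomy j s with hj | rfl | hj
    · rw [gapGen_of_lt hj]; exact gen_comm h
    · rw [gapGen_self]; exact gen_commute_seg (cross_mem _ _) (by omega)
    · rw [gapGen_of_gt hj]; exact gen_comm (by omega)
  · rw [gapGen_self, gapGen_of_gt (by omega)]
    exact (gen_commute_seg (cross_mem _ _) (by omega)).symm
  · rw [gapGen_of_gt hi, gapGen_of_gt (by omega)]; exact gen_comm (by omega)

theorem halfTwist_commute_gapGen {s h i : ℕ} (hn : s + h + 1 < n) :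
    Commute (halfTwist n (s + 1) h) (gapGen n s (h + 1) i) := by
  rcases lt_trichotomy i s with hi | rfl | hi
  · rw [gapGen_of_lt hi]; exact (gen_commute_seg (halfTwist_mem _ _) (by omega)).symm
  · rw [gapGen_self]
    exact (commute_of_mem_segMonoid (halfTwist_mem _ _) fun j h1 h2 =>
      (gen_commute_cross (by omega) (by omega) (by omega)).symm).symm
  · rw [gapGen_of_gt hi]; exact (gen_commute_seg (halfTwist_mem _ _) (by omega)).symm

theorem linProd_gapGen_of_le {s g m : ℕ} (h : m ≤ s) : linProd (gapGen n s g) m = up n 0 m := by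
  induction m with
  | zero => rfl
  | succ m ih => rw [linProd, ih (by omega), gapGen_of_lt (by omega), up, zero_add]

/-- The linear Coxeter-like element: the rotation of all strands followed by a correction which moves
one strand back across the gap. -/
theorem linProd_gapGen (s g m : ℕ) :
    linProd (gapGen n s g) (s + 1 + m) = up n 0 (s + g + 1 + m) * dn n s g := by
  induction m with
  | zero =>
    have := up_add (n := n) 0 s (g + 1)
    rw [zero_add] at this
    rw [add_zero, linProd, linProd_gapGen_of_le le_rfl, gapGen_self, cross, ← mul_assoc, ← this]
    rfl
  | succ m ih =>
    have hc := (gen_commute_seg (n := n) (j := s + 1 + m + g) (dn_mem s g) (by omega)).eq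
    rw [← add_assoc, linProd, ih, gapGen_of_gt (by omega), mul_assoc, ← hc, ← add_assoc, up,
      mul_assoc, show 0 + (s + g + 1 + m) = s + 1 + m + g by omega]

/-- The `j`-th power of the rotation of all strands raises indices by `j`. -/
theorem pow_up_shift {j k : ℕ} (h : j + k ≤ n) :
    up n 0 n ^ j * dn n 0 k = dn n j k * up n 0 n ^ j ∧
      up n 0 n ^ j * halfTwist n 0 k = halfTwist n j k * up n 0 n ^ j := by
  induction j with
  | zero => simp
  | succ j ih =>
    have hs : ∀ i, j ≤ i → i < j + k → up n 0 n * σ i = σ (i + 1) * up n 0 n :=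
      fun i h1 h2 => up_mul_gen (by omega) (by omega) (by omega)
    obtain ⟨i1, i2⟩ := ih (by omega)
    constructor
    · rw [pow_succ', mul_assoc, i1, ← mul_assoc, dn_shift hs, mul_assoc]
    · rw [pow_succ', mul_assoc, i2, ← mul_assoc, halfTwist_shift hs, mul_assoc]

/-- The square of the half twist expressed through the bipartite Coxeter-like element. -/
theorem halfTwist_sq_mul_bipartite_pow {s h r : ℕ} (hn : s + h + r + 2 = n) :
    halfTwist n (s + 1) h ^ 2 * (altProd (gapGen n s (h + 1)) 0 (s + 1 + r) *
      altProd (gapGen n s (h + 1)) 1 (s + 1 + r)) ^ (s + r + 2) = halfTwist n 0 n ^ 2 := by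
  obtain ⟨Y, hY, hz⟩ := exists_semiconj_bipartite (x := gapGen n s (h + 1))
    (fun i j => gapGen_commute) (s + 1 + r) 1 (fun _ _ => Commute.one_left _)
  rw [mul_one, mul_one, linProd_gapGen, show s + (h + 1) + 1 + r = n by omega] at hY
  have hX : SemiconjBy (up n 0 n ^ (s + 1)) (eps n (h + 1) (s + r + 1))
      (up n 0 n * dn n s (h + 1)) := by
    rw [SemiconjBy, eps, show h + 1 + (s + r + 1) = n by omega, pow_succ']
    have := (pow_up_shift (n := n) (j := s) (k := h + 1) (by omega)).1
    rw [mul_assoc, ← mul_assoc (_ ^ s), this, ← pow_succ', pow_succ]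
    simp only [mul_assoc]
  have hYX := (hY.mul_left hX).pow_right (s + r + 2)
  rw [SemiconjBy] at hYX
  have hG : Commute (halfTwist n (s + 1) h ^ 2) Y :=
    hz _ (fun i _ => (halfTwist_commute_gapGen (by omega)).pow_left 2) (Commute.one_right _)
  have hS : SemiconjBy (up n 0 n ^ (s + 1)) (halfTwist n 0 h ^ 2) (halfTwist n (s + 1) h ^ 2) :=
    SemiconjBy.pow_right (pow_up_shift (n := n) (j := s + 1) (k := h) (by omega)).2 2
  have hE := halfTwist_sq_mul_eps_pow (n := n) (h := h) (q := s + r + 1) (by omega)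
  rw [show h + 1 + (s + r + 1) = n by omega] at hE
  refine br_mul_right_cancel (x := Y * up n 0 n ^ (s + 1)) ?_
  rw [mul_assoc, ← hYX, mul_assoc Y, ← mul_assoc, hG.eq, mul_assoc, ← mul_assoc (_ ^ 2),
    ← hS.eq, mul_assoc, hE, ← mul_assoc, (commute_halfTwist_sq _).eq]

end Gap

/-! ### The symmetric group and square free elements -/

section Perm

variable {n : ℕ}

local notation "τ" => T (CoxeterMatrix.A n)
local notation "ℓ" => len (CoxeterMatrix.A n)
local notation "W" => CoxeterMatrix.Group (CoxeterMatrix.A n)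
local notation "σ" => gen n

/-- The transposition of `i` and `i + 1`. -/
def adj (i : ℕ) : Equiv.Perm ℕ := Equiv.swap i (i + 1)

theorem adj_left (i : ℕ) : adj i i = i + 1 := Equiv.swap_apply_left _ _

theorem adj_right (i : ℕ) : adj i (i + 1) = i := Equiv.swap_apply_right _ _

theorem adj_of_ne {i p : ℕ} (h1 : p ≠ i) (h2 : p ≠ i + 1) : adj i p = p :=
  Equiv.swap_apply_of_ne_of_ne h1 h2

theorem adj_apply (i p : ℕ) : adj i p = if p = i then i + 1 else if p = i + 1 then i else p :=
  Equiv.swap_apply_def _ _ _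

@[simp] theorem adj_adj (i p : ℕ) : adj i (adj i p) = p := Equiv.swap_apply_self _ _ _

@[simp] theorem adj_mul_self (i : ℕ) : adj i * adj i = 1 := Equiv.swap_mul_self _ _

theorem exists_permHom (n : ℕ) : ∃ φ : (CoxeterMatrix.A n).Group →* Equiv.Perm ℕ,
    ∀ i : Fin n, φ ((CoxeterMatrix.A n).simple i) = adj i := by
  have hl : (CoxeterMatrix.A n).IsLiftable (fun i : Fin n => adj i) := by
    intro i j
    rcases eq_or_near_or_far i j with rfl | h | h
    · simp
    · rw [A_near h]
      ext p
      unfold Near at h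
      rcases h with h | h <;>
      · simp only [pow_succ, pow_zero, one_mul, Equiv.Perm.mul_apply, adj_apply,
          Equiv.Perm.one_apply]
        grind
    · rw [A_far h]
      ext p
      unfold Far at h
      simp only [pow_succ, pow_zero, one_mul, Equiv.Perm.mul_apply, adj_apply,
        Equiv.Perm.one_apply]
      grind
  exact ⟨(CoxeterMatrix.A n).toCoxeterSystem.lift ⟨_, hl⟩, fun i =>
    (CoxeterMatrix.A n).toCoxeterSystem.lift_apply_simple hl i⟩

/-- The action of the Coxeter group of type `A` on the strands. -/
noncomputable def permHom (n : ℕ) : (CoxeterMatrix.A n).Group →* Equiv.Perm ℕ :=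
  (exists_permHom n).choose

@[simp] theorem permHom_simple (i : Fin n) :
    permHom n ((CoxeterMatrix.A n).simple i) = adj i := (exists_permHom n).choose_spec i

/-- The permutation of the strands given by a positive braid. -/
noncomputable def perm (n : ℕ) : Br n →* Equiv.Perm ℕ := (permHom n).comp (toCoxeter _)

@[simp] theorem perm_T (i : Fin n) : perm n (τ i) = adj i := permHom_simple i

theorem perm_eq (x : Br n) : perm n x = permHom n (toCoxeter _ x) := rfl

theorem perm_inv_T_mul (i : Fin n) (x : Br n) : (perm n (τ i * x))⁻¹ = (perm n x)⁻¹ * adj i := by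
  rw [map_mul, perm_T, mul_inv_rev]
  congr 1

/-- The inversions of a permutation on `{0, …, n}`. -/
def inversions (n : ℕ) (f : Equiv.Perm ℕ) : Finset (ℕ × ℕ) :=
  (Finset.range (n + 1) ×ˢ Finset.range (n + 1)).filter fun p => p.1 < p.2 ∧ f p.2 < f p.1

theorem mem_inversions {f : Equiv.Perm ℕ} {p q : ℕ} :
    (p, q) ∈ inversions n f ↔ p < q ∧ q ≤ n ∧ f q < f p := by
  simp only [inversions, Finset.mem_filter, Finset.mem_product, Finset.mem_range]
  omega

/-- Multiplication by an adjacent transposition at an ascent creates exactly one inversion. -/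
theorem card_inversions_mul_adj {f : Equiv.Perm ℕ} {i : ℕ} (hi : i < n) (h : f i < f (i + 1)) :
    (inversions n (f * adj i)).card = (inversions n f).card + 1 := by
  have hinj : Function.Injective (Prod.map (adj i) (adj i)) :=
    (adj i).injective.prodMap (adj i).injective
  have hset : inversions n (f * adj i) =
      insert (i, i + 1) ((inversions n f).image (Prod.map (adj i) (adj i))) := by
    ext ⟨p, q⟩
    have hmem : (p, q) ∈ (inversions n f).image (Prod.map (adj i) (adj i)) ↔
        (adj i p, adj i q) ∈ inversions n f := by
      rw [Finset.mem_image]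
      constructor
      · rintro ⟨⟨a, b⟩, hab, e⟩
        obtain ⟨rfl, rfl⟩ := Prod.mk.inj e
        simpa using hab
      · intro hab
        exact ⟨_, hab, by simp⟩
    rw [Finset.mem_insert, hmem, mem_inversions, mem_inversions, Prod.mk.injEq,
      Equiv.Perm.mul_apply, Equiv.Perm.mul_apply]
    by_cases he : p = i ∧ q = i + 1
    · obtain ⟨rfl, rfl⟩ := he
      rw [adj_left, adj_right]
      simp only [and_self, true_or, iff_true]
      omega
    · have e1 := adj_apply i p
      have e2 := adj_apply i q
      have key : adj i p < adj i q ∧ adj i q ≤ n → p < q ∧ q ≤ n ∨ (p = i + 1 ∧ q = i) := by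
        split_ifs at e1 e2 <;> omega
      have key2 : p < q ∧ q ≤ n → adj i p < adj i q ∧ adj i q ≤ n := by
        split_ifs at e1 e2 <;> omega
      simp only [he, false_or]
      constructor
      · rintro ⟨h1, h2, h3⟩
        exact ⟨(key2 ⟨h1, h2⟩).1, (key2 ⟨h1, h2⟩).2, h3⟩
      · rintro ⟨h1, h2, h3⟩
        rcases key ⟨h1, h2⟩ with h4 | ⟨rfl, rfl⟩
        · exact ⟨h4.1, h4.2, h3⟩
        · rw [adj_left, adj_right] at h3
          omega
  rw [hset, Finset.card_insert_of_notMem, Finset.card_image_of_injective _ hinj]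
  rw [Finset.mem_image]
  rintro ⟨⟨a, b⟩, hab, e⟩
  obtain ⟨e1, e2⟩ := Prod.mk.inj e
  have h1 := congrArg (adj i) e1
  have h2 := congrArg (adj i) e2
  rw [adj_adj, adj_left] at h1
  rw [adj_adj, adj_right] at h2
  rw [mem_inversions] at hab
  omega

theorem card_inversions_mul_adj_of_gt {f : Equiv.Perm ℕ} {i : ℕ} (hi : i < n)
    (h : f (i + 1) < f i) :
    (inversions n (f * adj i)).card + 1 = (inversions n f).card := by
  rw [← card_inversions_mul_adj hi (f := f * adj i)
    (by rw [Equiv.Perm.mul_apply, Equiv.Perm.mul_apply, adj_left, adj_right]; exact h),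
    mul_assoc, adj_mul_self, mul_one]

/-- The positive braid `x` has as many letters as its permutation has inversions. -/
def IsRed (x : Br n) : Prop := (inversions n (perm n x)⁻¹).card = ℓ x

theorem card_inversions_le (x : Br n) : (inversions n (perm n x)⁻¹).card ≤ ℓ x := by
  induction x using artin_induction with
  | one =>
    rw [map_one, inv_one, len_one, Nat.le_zero, Finset.card_eq_zero]
    ext ⟨p, q⟩
    rw [mem_inversions]
    simp
    omega
  | mul i x ih =>
    rw [perm_inv_T_mul, len_mul, len_T]
    rcases lt_trichotomy ((perm n x)⁻¹ i) ((perm n x)⁻¹ (i + 1)) with h | h | h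
    · rw [card_inversions_mul_adj i.2 h]; omega
    · exact absurd ((perm n x)⁻¹.injective h) (by omega)
    · have := card_inversions_mul_adj_of_gt i.2 h; omega

theorem isRed_T_mul {i : Fin n} {x : Br n} :
    IsRed (τ i * x) ↔ IsRed x ∧ (perm n x)⁻¹ i < (perm n x)⁻¹ (i + 1) := by
  have hle := card_inversions_le x
  unfold IsRed
  rw [perm_inv_T_mul, len_mul, len_T]
  rcases lt_trichotomy ((perm n x)⁻¹ i) ((perm n x)⁻¹ (i + 1)) with h | h | h
  · rw [card_inversions_mul_adj i.2 h]; omega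
  · exact absurd ((perm n x)⁻¹.injective h) (by omega)
  · have := card_inversions_mul_adj_of_gt i.2 h; omega

theorem IsRed.descent {i : Fin n} {x : Br n} (h : IsRed x) (hd : τ i ∣ x) :
    (perm n x)⁻¹ (i + 1) < (perm n x)⁻¹ i := by
  obtain ⟨y, rfl⟩ := hd
  rw [perm_inv_T_mul, Equiv.Perm.mul_apply, Equiv.Perm.mul_apply, adj_left, adj_right]
  exact (isRed_T_mul.1 h).2

/-- The exchange property in the positive braid monoid: a reduced braid is divisible on the left
by the generator of every descent of its permutation. -/
theorem IsRed.dvd {i : Fin n} {x : Br n} (h : IsRed x)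
    (hd : (perm n x)⁻¹ (i + 1) < (perm n x)⁻¹ i) : τ i ∣ x := by
  obtain ⟨L, hL⟩ : ∃ L, ℓ x = L := ⟨_, rfl⟩
  induction L using Nat.strong_induction_on generalizing i x with
  | _ L ih =>
    rcases eq_one_or_eq_T_mul _ x with rfl | ⟨j, y, rfl⟩
    · simp at hd
    · rw [len_mul, len_T] at hL
      obtain ⟨hy, hj⟩ := isRed_T_mul.1 h
      rw [perm_inv_T_mul, Equiv.Perm.mul_apply, Equiv.Perm.mul_apply] at hd
      rcases eq_or_near_or_far i j with rfl | e | e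
      · exact dvd_mul_right _ _
      · have hi : τ i ∣ y := by
          refine ih _ (by omega) hy ?_ rfl
          unfold Near at e
          rcases e with e | e
          · rw [← e, adj_left, adj_of_ne (by omega) (by omega)] at hd
            rw [← e] at hj
            omega
          · rw [← e, adj_right, adj_of_ne (by omega) (by omega)] at hd
            rw [← e]
            exact hd.trans hj
        obtain ⟨z, rfl⟩ := hi
        obtain ⟨hz, hi⟩ := isRed_T_mul.1 hy
        rw [perm_inv_T_mul] at hj hd
        simp only [Equiv.Perm.mul_apply] at hj hd
        have hjz : τ j ∣ z := by
          rw [len_mul, len_T] at hL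
          refine ih _ (by omega) hz ?_ rfl
          unfold Near at e
          rcases e with e | e
          · rw [← e] at hd hj ⊢
            rwa [adj_left, adj_of_ne (i := i) (p := i + 1 + 1) (by omega) (by omega),
              adj_of_ne (i := i + 1) (p := i) (by omega) (by omega), adj_left] at hd
          · rw [← e] at hd hj hi
            rwa [adj_of_ne (i := j) (p := j + 1 + 1) (by omega) (by omega), adj_right (j + 1),
              adj_right j, adj_of_ne (i := j + 1) (p := j) (by omega) (by omega)] at hd
        obtain ⟨w, rfl⟩ := hjz
        rw [T_braid_mul e.symm]
        exact dvd_mul_right _ _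
      · have hi : τ i ∣ y := by
          refine ih _ (by omega) hy ?_ rfl
          unfold Far at e
          rwa [adj_of_ne (by omega) (by omega), adj_of_ne (by omega) (by omega)] at hd
        obtain ⟨z, rfl⟩ := hi
        rw [T_comm_mul e.symm]
        exact dvd_mul_right _ _

theorem IsRed.eq_of_perm_eq {x y : Br n} (hx : IsRed x) (hy : IsRed y)
    (h : perm n x = perm n y) : x = y := by
  induction x using artin_induction generalizing y with
  | one =>
    rw [IsRed, ← h, hx, len_one] at hy
    exact (eq_one_of_len_eq_zero _ hy.symm).symm
  | mul i x ih =>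
    have hd := hx.descent (dvd_mul_right (τ i) x)
    rw [h] at hd
    obtain ⟨z, rfl⟩ := hy.dvd hd
    rw [map_mul, map_mul] at h
    rw [ih (isRed_T_mul.1 hx).1 (isRed_T_mul.1 hy).1 (mul_left_cancel h)]

end Perm

section SquareFree

variable {B : Type*} (M : CoxeterMatrix B)

theorem coxLen_le_len (x : ArtinMonoid M) : coxLen M (toCoxeter M x) ≤ len M x := by
  induction x using artin_induction with
  | one => rw [map_one, len_one]; exact (M.toCoxeterSystem.length_one).le
  | mul i x ih =>
    rw [map_mul, len_mul]
    refine (M.toCoxeterSystem.length_mul_le _ _).trans (Nat.add_le_add ?_ ih)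
    exact (M.toCoxeterSystem.length_simple i).le

variable {M}

theorem IsSquareFree.of_mul {x y : ArtinMonoid M} (h : IsSquareFree M (x * y)) :
    IsSquareFree M x ∧ IsSquareFree M y := by
  unfold IsSquareFree at *
  have h1 := coxLen_le_len M x
  have h2 := coxLen_le_len M y
  have h3 : coxLen M (toCoxeter M (x * y)) ≤
      coxLen M (toCoxeter M x) + coxLen M (toCoxeter M y) := by
    rw [map_mul]; exact M.toCoxeterSystem.length_mul_le _ _
  rw [len_mul] at h
  omega

theorem IsSquareFree.of_dvd {x y : ArtinMonoid M} (h : IsSquareFree M y) (hd : x ∣ y) :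
    IsSquareFree M x := by
  obtain ⟨z, rfl⟩ := hd
  exact h.of_mul.1

theorem not_squareFree_T_mul_T (i : B) (x : ArtinMonoid M) :
    ¬ IsSquareFree M (T M i * (T M i * x)) := by
  intro h
  have h2 : toCoxeter M (T M i * (T M i * x)) = toCoxeter M x := by
    rw [map_mul, map_mul, toCoxeter_T, ← mul_assoc, ← CoxeterMatrix.toCoxeterSystem_simple,
      CoxeterSystem.simple_mul_simple_self, one_mul]
  have h3 := coxLen_le_len M x
  rw [IsSquareFree, h2, len_mul, len_mul, len_T] at h
  omega

theorem sqfLift_squareFree (w : M.Group) : IsSquareFree M (sqfLift M w) :=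
  (exists_squareFree M w).choose_spec.1

@[simp] theorem toCoxeter_sqfLift (w : M.Group) : toCoxeter M (sqfLift M w) = w :=
  (exists_squareFree M w).choose_spec.2

theorem len_sqfLift (w : M.Group) : len M (sqfLift M w) = coxLen M w := by
  rw [← sqfLift_squareFree w, toCoxeter_sqfLift]

end SquareFree

section SquareFreeA

variable {n : ℕ}

local notation "τ" => T (CoxeterMatrix.A n)
local notation "ℓ" => len (CoxeterMatrix.A n)
local notation "σ" => gen n
local notation "SqF" => IsSquareFree (CoxeterMatrix.A n)

theorem isSquareFree_iff_isRed {x : Br n} : SqF x ↔ IsRed x := by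
  constructor
  · intro h
    induction x using artin_induction with
    | one => exact le_antisymm (card_inversions_le 1) (by rw [len_one]; exact Nat.zero_le _)
    | mul i x ih =>
      have hx := ih h.of_mul.2
      refine isRed_T_mul.2 ⟨hx, ?_⟩
      by_contra hd
      have hne : (perm n x)⁻¹ (i + 1) ≠ (perm n x)⁻¹ i :=
        fun e => absurd ((perm n x)⁻¹.injective e) (by omega)
      -- otherwise `T_i²` divides the element, which is then not square free
      obtain ⟨y, rfl⟩ := hx.dvd (i := i) (by omega)
      exact not_squareFree_T_mul_T i y h
  · intro h
    refine le_antisymm (coxLen_le_len _ x) ?_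
    have h1 := card_inversions_le (sqfLift _ (toCoxeter _ x))
    rwa [perm_eq, toCoxeter_sqfLift, ← perm_eq, h, len_sqfLift] at h1

/-- Uniqueness of square free lifts. -/
theorem sqfLift_toCoxeter {x : Br n} (h : SqF x) : sqfLift _ (toCoxeter _ x) = x := by
  refine IsRed.eq_of_perm_eq (isSquareFree_iff_isRed.1 (sqfLift_squareFree _))
    (isSquareFree_iff_isRed.1 h) ?_
  rw [perm_eq, toCoxeter_sqfLift, perm_eq]

theorem permHom_injective : Function.Injective (permHom n) := by
  intro u v h
  have := IsRed.eq_of_perm_eq (isSquareFree_iff_isRed.1 (sqfLift_squareFree u))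
    (isSquareFree_iff_isRed.1 (sqfLift_squareFree v))
    (by rwa [perm_eq, toCoxeter_sqfLift, perm_eq, toCoxeter_sqfLift])
  rw [← toCoxeter_sqfLift u, this, toCoxeter_sqfLift]

theorem coxLen_eq_card (u : (CoxeterMatrix.A n).Group) :
    coxLen _ u = (inversions n (permHom n u)⁻¹).card := by
  have h := isSquareFree_iff_isRed.1 (sqfLift_squareFree u)
  rw [IsRed, len_sqfLift, perm_eq, toCoxeter_sqfLift] at h
  exact h.symm

theorem permHom_of_gt (u : (CoxeterMatrix.A n).Group) {q : ℕ} (hq : n < q) :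
    permHom n u q = q := by
  induction u using (CoxeterMatrix.A n).toCoxeterSystem.simple_induction_left with
  | one => simp
  | mul_simple_left w i ih =>
    rw [CoxeterMatrix.toCoxeterSystem_simple, map_mul, permHom_simple, Equiv.Perm.mul_apply, ih,
      adj_of_ne (by omega) (by omega)]

theorem permHom_inv_of_gt (u : (CoxeterMatrix.A n).Group) {q : ℕ} (hq : n < q) :
    (permHom n u)⁻¹ q = q := by
  rw [← map_inv]; exact permHom_of_gt _ hq

theorem permHom_inv_le (u : (CoxeterMatrix.A n).Group) {q : ℕ} (hq : q ≤ n) :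
    (permHom n u)⁻¹ q ≤ n := by
  by_contra h
  have h1 := permHom_inv_of_gt u (q := (permHom n u)⁻¹ q) (by omega)
  exact h (((permHom n u)⁻¹.injective h1).le.trans hq)

/-- An element of the Coxeter group is determined by the inversions of its permutation. -/
theorem eq_of_inversions_eq {u v : (CoxeterMatrix.A n).Group}
    (h : inversions n (permHom n u)⁻¹ = inversions n (permHom n v)⁻¹) : u = v := by
  have hle : ∀ p q, p < q → ((permHom n u)⁻¹ q < (permHom n u)⁻¹ p ↔
      (permHom n v)⁻¹ q < (permHom n v)⁻¹ p) := by
    intro p q hpq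
    rcases Nat.lt_or_ge n q with hq | hq
    · have hp : ∀ w : (CoxeterMatrix.A n).Group, ¬ (permHom n w)⁻¹ q < (permHom n w)⁻¹ p := by
        intro w
        rw [permHom_inv_of_gt w hq]
        rcases Nat.lt_or_ge n p with hp | hp
        · rw [permHom_inv_of_gt w hp]; omega
        · have := permHom_inv_le w hp; omega
      exact iff_of_false (hp u) (hp v)
    · have := Finset.ext_iff.1 h (p, q)
      rw [mem_inversions, mem_inversions] at this
      tauto
  have hlt : ∀ p q, (permHom n u)⁻¹ p < (permHom n u)⁻¹ q →
      (permHom n v)⁻¹ p < (permHom n v)⁻¹ q := by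
    intro p q hpq
    rcases lt_trichotomy p q with h1 | rfl | h1
    · have h2 := (hle p q h1).not
      have h3 : (permHom n v)⁻¹ p ≠ (permHom n v)⁻¹ q :=
        fun e => h1.ne ((permHom n v)⁻¹.injective e)
      omega
    · exact absurd hpq (lt_irrefl _)
    · exact (hle q p h1).1 hpq
  -- the quotient of the two permutations is a strictly monotone permutation of `ℕ`
  have hmono : StrictMono ((permHom n v)⁻¹ * permHom n u : Equiv.Perm ℕ) := by
    intro p q hpq
    rw [Equiv.Perm.mul_apply, Equiv.Perm.mul_apply]
    exact hlt _ _ (by simpa using hpq)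
  have h1 : ((permHom n v)⁻¹ * permHom n u : Equiv.Perm ℕ) = 1 := by
    ext p
    have := congrArg (fun e : ℕ ≃o ℕ => e p)
      (Subsingleton.elim (hmono.orderIsoOfSurjective _ (Equiv.surjective _)) (OrderIso.refl ℕ))
    simpa using this
  exact permHom_injective (inv_mul_eq_one.1 h1).symm

/-- The elements of `W_J` preserve the initial segments of strands that are cut off by a generator
outside of `J`. -/
theorem le_iff_of_mem_parabolicSubgroup {J : Set (Fin n)} {u : (CoxeterMatrix.A n).Group}
    (hu : u ∈ parabolicSubgroup _ J) {i : Fin n} (hi : i ∉ J) (p : ℕ) :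
    permHom n u p ≤ i ↔ p ≤ i := by
  induction hu using Subgroup.closure_induction generalizing p with
  | mem u hu =>
    obtain ⟨j, hj, rfl⟩ := hu
    have hij : (i : ℕ) ≠ j := fun e => hi (Fin.ext e ▸ hj)
    rw [permHom_simple, adj_apply]
    split_ifs <;> omega
  | one => simp
  | mul u v _ _ hu hv => rw [map_mul, Equiv.Perm.mul_apply, hu, hv]
  | inv u _ hu => rw [← hu, map_inv]; simp

theorem toCoxeter_mem {J : Set (Fin n)} {x : Br n} (hx : x ∈ parabolicSubmonoid _ J) :
    toCoxeter _ x ∈ parabolicSubgroup (CoxeterMatrix.A n) J := by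
  induction hx using Submonoid.closure_induction with
  | mem x hx =>
    obtain ⟨j, hj, rfl⟩ := hx
    exact Subgroup.subset_closure ⟨j, hj, rfl⟩
  | one => rw [map_one]; exact one_mem _
  | mul x y _ _ hx hy => rw [map_mul]; exact mul_mem hx hy

/-- If all `T_j` with `j ∈ J` divide a square free `x`, then every element of `W_J` is at most as long
as the image of `x`, and is equal to it if it is as long: inversions of elements of `W_J` only occur
within the blocks of consecutive strands joined by `J`, and on these `x` reverses the order. -/
theorem le_coxLen_of_forall_dvd {J : Set (Fin n)} {x : Br n} (hs : SqF x) (hd : ∀ j ∈ J, τ j ∣ x)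
    {u : (CoxeterMatrix.A n).Group} (hu : u ∈ parabolicSubgroup _ J) :
    coxLen _ u ≤ coxLen _ (toCoxeter _ x) ∧
      (coxLen _ (toCoxeter _ x) ≤ coxLen _ u → u = toCoxeter _ x) := by
  have hr := isSquareFree_iff_isRed.1 hs
  have hdesc : ∀ p q : ℕ, p < q → (∀ i : ℕ, p ≤ i → i < q → ∃ h : i < n, (⟨i, h⟩ : Fin n) ∈ J) →
      (perm n x)⁻¹ q < (perm n x)⁻¹ p := by
    intro p q hpq
    induction q, hpq using Nat.le_induction with
    | base =>
      intro h
      obtain ⟨h1, h2⟩ := h p le_rfl (Nat.lt_succ_self p)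
      exact hr.descent (hd _ h2)
    | succ q hq ih =>
      intro h
      obtain ⟨h1, h2⟩ := h q (by omega) (Nat.lt_succ_self q)
      exact (hr.descent (hd _ h2)).trans (ih fun i h3 h4 => h i h3 (by omega))
  have hsub : inversions n (permHom n u)⁻¹ ⊆ inversions n (permHom n (toCoxeter _ x))⁻¹ := by
    rintro ⟨p, q⟩ hpq
    rw [mem_inversions] at *
    refine ⟨hpq.1, hpq.2.1, hdesc p q hpq.1 fun i h1 h2 => ⟨by omega, ?_⟩⟩
    by_contra hi
    have h3 := le_iff_of_mem_parabolicSubgroup (inv_mem hu) hi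
    simp only [map_inv] at h3
    have h4 := (h3 p).2 h1
    have h5 := (h3 q).not.2 (by simpa using h2)
    omega
  rw [coxLen_eq_card, coxLen_eq_card]
  exact ⟨Finset.card_le_card hsub,
    fun h => eq_of_inversions_eq (Finset.eq_of_subset_of_card_le hsub h)⟩

/-- A square free element of a parabolic submonoid divisible by all generators of this submonoid
lifts the longest element. -/
theorem longest_eq {J : Set (Fin n)} {x : Br n} (hs : SqF x) (hx : x ∈ parabolicSubmonoid _ J)
    (hd : ∀ j ∈ J, τ j ∣ x) : longest _ J = toCoxeter _ x := by
  have hex : ∃ w ∈ parabolicSubgroup (CoxeterMatrix.A n) J,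
      ∀ u ∈ parabolicSubgroup _ J, coxLen _ u ≤ coxLen _ w :=
    ⟨_, toCoxeter_mem hx, fun u hu => (le_coxLen_of_forall_dvd hs hd hu).1⟩
  rw [longest, dif_pos hex]
  exact (le_coxLen_of_forall_dvd hs hd hex.choose_spec.1).2
    (hex.choose_spec.2 _ (toCoxeter_mem hx))

theorem toCoxeter_inv_eq {J : Set (Fin n)} {x : Br n} (hs : SqF x)
    (hx : x ∈ parabolicSubmonoid _ J) (hd : ∀ j ∈ J, τ j ∣ x) :
    (toCoxeter _ x)⁻¹ = toCoxeter _ x :=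
  (le_coxLen_of_forall_dvd hs hd (inv_mem (toCoxeter_mem hx))).2
    ((CoxeterMatrix.A n).toCoxeterSystem.length_inv _).ge

/-- The half twist on all strands is square free: it divides the lift of an element of maximal
length. -/
theorem halfTwist_squareFree : SqF (halfTwist n 0 n) := by
  have hbd : ∀ u : (CoxeterMatrix.A n).Group, coxLen _ u ≤ (n + 1) * (n + 1) := by
    intro u
    rw [coxLen_eq_card]
    refine (Finset.card_filter_le _ _).trans ?_
    rw [Finset.card_product, Finset.card_range]
  obtain ⟨w, hw⟩ : ∃ w : (CoxeterMatrix.A n).Group, ∀ u, coxLen _ u ≤ coxLen _ w := by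
    by_contra! hcon
    have : ∀ k : ℕ, ∃ u : (CoxeterMatrix.A n).Group, k ≤ coxLen _ u := by
      intro k
      induction k with
      | zero => exact ⟨1, Nat.zero_le _⟩
      | succ k ih =>
        obtain ⟨u, hu⟩ := ih
        obtain ⟨v, hv⟩ := hcon u
        exact ⟨v, by omega⟩
    obtain ⟨u, hu⟩ := this ((n + 1) * (n + 1) + 1)
    have := hbd u
    omega
  refine (sqfLift_squareFree w).of_dvd (halfTwist_dvd (by omega) fun i _ hi => ?_)
  rw [gen_of_lt (by omega)]
  have hr := isSquareFree_iff_isRed.1 (sqfLift_squareFree w)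
  refine hr.dvd ?_
  by_contra hd
  have hne : (perm n (sqfLift _ w))⁻¹ (i + 1) ≠ (perm n (sqfLift _ w))⁻¹ i :=
    fun e => absurd ((perm n (sqfLift _ w))⁻¹.injective e) (by omega)
  have h1 : SqF (τ ⟨i, by omega⟩ * sqfLift _ w) :=
    isSquareFree_iff_isRed.2 (isRed_T_mul.2 ⟨hr, lt_of_le_of_ne (not_lt.1 hd) hne.symm⟩)
  have h2 := hw (toCoxeter _ (τ ⟨i, by omega⟩ * sqfLift _ w))
  rw [h1, len_mul, len_T, len_sqfLift] at h2
  omega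

end SquareFreeA

/-! ### Alternating products -/

section Brd

variable {N : Type*} [Monoid N]

theorem brd_two_mul (x y : N) (k : ℕ) : brd x y (2 * k) = (x * y) ^ k := by
  simp [brd]

theorem brd_succ (x y : N) (k : ℕ) : brd x y (k + 1) = x * brd y x k := by
  rcases Nat.even_or_odd' k with ⟨j, rfl | rfl⟩
  · have h1 : (2 * j + 1) / 2 = j := by omega
    have h2 : (2 * j + 1) % 2 = 1 := by omega
    rw [brd_two_mul, brd, h1, h2, pow_one, mul_pow_mul]
  · have h1 : (2 * j + 1) / 2 = j := by omega
    have h2 : (2 * j + 1) % 2 = 1 := by omega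
    rw [show 2 * j + 1 + 1 = 2 * (j + 1) by ring, brd_two_mul, brd, h1, h2, pow_one, pow_succ,
      ← mul_assoc, ← mul_assoc, ← mul_pow_mul, mul_assoc]

@[simp] theorem brd_zero (x y : N) : brd x y 0 = 1 := by simp [brd]

theorem brd_add (x y : N) (k l : ℕ) :
    brd x y (k + l) = brd x y k * (if k % 2 = 0 then brd x y l else brd y x l) := by
  induction k generalizing x y with
  | zero => simp
  | succ k ih =>
    rw [add_right_comm, brd_succ, ih, brd_succ, mul_assoc]
    rcases Nat.mod_two_eq_zero_or_one k with h | h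
    · rw [if_pos h, if_neg (by omega)]
    · rw [if_neg (by omega), if_pos (by omega)]

theorem braidSet_comm (x y : N) : braidSet x y = braidSet y x := by
  ext k
  exact and_congr_right fun _ => eq_comm

end Brd

section Gap

variable {n : ℕ}

local notation "τ" => T (CoxeterMatrix.A n)
local notation "ℓ" => len (CoxeterMatrix.A n)
local notation "σ" => gen n
local notation "SqF" => IsSquareFree (CoxeterMatrix.A n)
local notation "Δ" => halfTwist n 0 n

/-- The set of lengths of braid relations between two elements is closed under differences, by
cancellation. -/
theorem sub_mem_braidSet {x y : Br n} {k l : ℕ} (hk : k ∈ braidSet x y) (hl : l ∈ braidSet x y)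
    (h : k < l) : l - k ∈ braidSet x y := by
  refine ⟨by omega, ?_⟩
  have e := hl.2
  rw [show l = k + (l - k) by omega, brd_add, brd_add, hk.2] at e
  have e := br_mul_left_cancel e
  split_ifs at e
  · exact e
  · exact e.symm

/-! ### Lifts of longest elements dividing the half twist -/

theorem mem_parabolicSubmonoid_of_seg {s k : ℕ} {u Q : Br n} (hu : u ∈ segMonoid n s k)
    (h : ∀ i, s ≤ i → i < s + k → σ i ∣ Q) :
    u ∈ parabolicSubmonoid (CoxeterMatrix.A n) {i | τ i ∣ Q} := by
  induction hu using Submonoid.closure_induction with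
  | mem x hx =>
    obtain ⟨i, hi, rfl⟩ := hx
    have h1 := h i hi.1 hi.2
    rcases Nat.lt_or_ge i n with h2 | h2
    · rw [gen_of_lt h2] at h1 ⊢
      exact Submonoid.subset_closure ⟨_, h1, rfl⟩
    · rw [gen, dif_neg (by omega)]
      exact one_mem _
  | one => exact one_mem _
  | mul x y _ _ hx hy => exact mul_mem hx hy

theorem mem_parabolicSubmonoid_univ (x : Br n) :
    x ∈ parabolicSubmonoid (CoxeterMatrix.A n) Set.univ := by
  induction x using artin_induction with
  | one => exact one_mem _
  | mul i x ih => exact mul_mem (Submonoid.subset_closure ⟨i, trivial, rfl⟩) ih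

theorem T_dvd_halfTwist (i : Fin n) : τ i ∣ Δ := by
  rw [← gen_val]
  exact gen_dvd_halfTwist (Nat.zero_le _) (by omega) (by omega)

theorem longest_univ : longest (CoxeterMatrix.A n) Set.univ = toCoxeter _ Δ :=
  longest_eq halfTwist_squareFree (mem_parabolicSubmonoid_univ _) fun i _ => T_dvd_halfTwist i

theorem isComponent_univ (hn : 0 < n) :
    IsComponent (CoxeterMatrix.A n) Set.univ Set.univ := by
  refine ⟨SimpleGraph.connectedComponentMk _ ⟨⟨0, hn⟩, trivial⟩, ?_⟩
  have h : ∀ (i : ℕ) (hi : i < n),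
      ((coxeterGraph (CoxeterMatrix.A n)).induce Set.univ).Reachable ⟨⟨i, hi⟩, trivial⟩
        ⟨⟨0, hn⟩, trivial⟩ := by
    intro i
    induction i with
    | zero => exact fun hi => SimpleGraph.Reachable.refl _
    | succ i ih =>
      intro hi
      refine SimpleGraph.Reachable.trans (SimpleGraph.Adj.reachable ?_) (ih (by omega))
      refine ⟨fun e => ?_, ?_⟩
      · have := congrArg Fin.val e
        simp at this
      · have : Near (⟨i + 1, hi⟩ : Fin n) ⟨i, by omega⟩ := Or.inr rfl
        change CoxeterMatrix.A n ⟨i + 1, hi⟩ ⟨i, by omega⟩ ≠ 2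
        rw [A_near this]
        norm_num
  ext i
  simp only [Set.mem_univ, true_iff, Set.mem_image]
  exact ⟨⟨i, trivial⟩, SimpleGraph.ConnectedComponent.sound (h i i.2), rfl⟩

/-- If `Q` divides the half twist and all its letters divide it, then `Q` lifts a longest element
and its complement is a parabolic element. -/
theorem mem_parabolicElements {Q Z : Br n} (hn : 0 < n)
    (hQ : Q ∈ parabolicSubmonoid (CoxeterMatrix.A n) {i | τ i ∣ Q}) (h : Q * Z = Δ) :
    Z ∈ parabolicElements (CoxeterMatrix.A n) Set.univ := by
  have hs : SqF (Q * Z) := h ▸ halfTwist_squareFree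
  refine Submonoid.subset_closure ⟨Set.univ, {i | τ i ∣ Q}, isComponent_univ hn,
    Set.subset_univ _, ?_⟩
  rw [longest_univ, longest_eq hs.of_mul.1 hQ fun _ h => h,
    ← toCoxeter_inv_eq hs.of_mul.1 hQ fun _ h => h, ← h, map_mul, inv_mul_cancel_left,
    sqfLift_toCoxeter hs.of_mul.2]

/-! ### Reflection by the half twist -/

theorem halfTwist_mul_gen {i : ℕ} (h : i < n) : Δ * σ i = σ (n - 1 - i) * Δ := by
  have h1 := gen_mul_halfTwist (n := n) (s := 0) (k := n) (i := n - 1 - i) (by omega) (by omega)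
  rw [show 0 + (n - 1 - (n - 1 - i)) = i by omega, zero_add] at h1
  exact h1.symm

theorem halfTwist_mul_dn {s k : ℕ} (h : s + k ≤ n) :
    Δ * dn n s k = up n (n - s - k) k * Δ := by
  induction k with
  | zero => simp [dn, up]
  | succ k ih =>
    rw [dn, ← mul_assoc, halfTwist_mul_gen (by omega), mul_assoc, ih (by omega), ← mul_assoc,
      up_succ', show n - 1 - (s + k) = n - s - (k + 1) by omega,
      show n - s - k = n - s - (k + 1) + 1 by omega]

theorem halfTwist_mul_halfTwist {s k : ℕ} (h : s + k ≤ n) :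
    Δ * halfTwist n s k = halfTwist n (n - s - k) k * Δ := by
  induction k with
  | zero => simp [halfTwist]
  | succ k ih =>
    rw [halfTwist, ← mul_assoc, ih (by omega), mul_assoc, halfTwist_mul_dn h, ← mul_assoc,
      show n - s - k = n - s - (k + 1) + 1 by omega, ← halfTwist_succ_right (by omega)]

/-! ### Divisibility properties of the bipartite products -/

section Bipartite

variable {s h r : ℕ}

theorem gapGen_dvd_altProd {e m i : ℕ} (hi : i < m) (he : i % 2 = e) :
    gapGen n s h i ∣ altProd (gapGen n s h) e m := by
  induction m with
  | zero => omega
  | succ m ih =>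
    rw [altProd]
    rcases Nat.lt_or_ge i m with h1 | h1
    · exact Dvd.dvd.mul_right (ih h1) _
    · obtain rfl : i = m := by omega
      have hc : Commute (gapGen n s h i) (altProd (gapGen n s h) e i) :=
        commute_altProd fun j hj hj2 => (gapGen_commute (by omega)).symm
      rw [if_pos he, ← hc.eq]
      exact dvd_mul_right _ _

/-- If `z` is divisible by the `i`-th generator attached to the set with a gap, then the half twist of
the gap times `z` is divisible by all letters `j` of this generator. -/
theorem gen_dvd_of_gapGen_dvd (hn : s + h + 1 < n) {i j : ℕ}
    (hj : j < s ∧ i = j ∨ s ≤ j ∧ j ≤ s + h + 1 ∧ i = s ∨ s < i ∧ j = i + (h + 1)) {z : Br n}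
    (hd : gapGen n s (h + 1) i ∣ z) : σ j ∣ halfTwist n (s + 1) h * z := by
  obtain ⟨w, rfl⟩ := hd
  rcases hj with ⟨h1, rfl⟩ | ⟨h1, h2, rfl⟩ | ⟨h1, rfl⟩
  · rw [← mul_assoc, (halfTwist_commute_gapGen hn).eq, gapGen_of_lt h1, mul_assoc]
    exact dvd_mul_right _ _
  · rw [gapGen_self, ← mul_assoc, halfTwist_mul_cross hn]
    exact Dvd.dvd.mul_right (gen_dvd_halfTwist (by omega) (by omega) (by omega)) _
  · rw [← mul_assoc, (halfTwist_commute_gapGen hn).eq, gapGen_of_gt h1, mul_assoc]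
    exact dvd_mul_right _ _

theorem halfTwist_dvd_of_forall_gapGen_dvd (hn : s + h + r + 2 = n) {z : Br n}
    (hd : ∀ i < s + 1 + r, gapGen n s (h + 1) i ∣ z) : Δ ∣ halfTwist n (s + 1) h * z := by
  refine halfTwist_dvd (by omega) fun j _ hj => ?_
  rcases Nat.lt_or_ge j s with h1 | h1
  · exact gen_dvd_of_gapGen_dvd (by omega) (Or.inl ⟨h1, rfl⟩) (hd j (by omega))
  · rcases Nat.lt_or_ge (s + h + 1) j with h2 | h2
    · exact gen_dvd_of_gapGen_dvd (i := j - (h + 1)) (by omega)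
        (Or.inr (Or.inr ⟨by omega, by omega⟩)) (hd _ (by omega))
    · exact gen_dvd_of_gapGen_dvd (by omega) (Or.inr (Or.inl ⟨h1, h2, rfl⟩)) (hd s (by omega))

theorem gapGen_mem_closure {i k : ℕ} (F : Set ℕ) (h1 : i < s → i ∈ F)
    (h2 : i = s → ∀ j, s ≤ j → j < s + (k + 1) → j ∈ F) (h3 : s < i → i + k ∈ F) :
    gapGen n s k i ∈ Submonoid.closure (gen n '' F) := by
  rcases lt_trichotomy i s with h | rfl | h
  · rw [gapGen_of_lt h]; exact Submonoid.subset_closure ⟨_, h1 h, rfl⟩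
  · rw [gapGen_self]
    exact Submonoid.closure_mono (Set.image_mono fun j hj => h2 rfl j hj.1 hj.2) (cross_mem i k)
  · rw [gapGen_of_gt h]; exact Submonoid.subset_closure ⟨_, h3 h, rfl⟩

/-- The half twist on the strands in the gap, multiplied with the partial products, divides the
half twist on all strands, since the factors are half twists on pairwise far intervals. -/
theorem halfTwist_mul_altProd_dvd (hn : s + h + r + 2 = n) (e m : ℕ) (hm : m ≤ s + 1 + r) :
    halfTwist n (s + 1) h * altProd (gapGen n s (h + 1)) e m ∣ Δ := by
  have hgap : ∀ i < n, σ i ∣ Δ := fun i hi =>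
    gen_dvd_halfTwist (Nat.zero_le _) (by omega) (by omega)
  induction m with
  | zero =>
    rw [altProd, mul_one]
    exact halfTwist_dvd (by omega) fun i h1 h2 => hgap i (by omega)
  | succ m ih =>
    obtain ⟨w, hw⟩ := ih (by omega)
    rw [altProd]
    split_ifs with hme
    · rw [hw, ← mul_assoc]
      refine mul_dvd_mul_left _ ?_
      -- all letters of the partial product are to the left of the new factor
      have hmem : ∀ c, c = (if m ≤ s then m else m + (h + 1)) →
          altProd (gapGen n s (h + 1)) e m ∈ Submonoid.closure (gen n '' {j | j + 1 < c}) := by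
        rintro c rfl
        refine altProd_induction (one_mem _) (fun _ _ => mul_mem) fun i hi hie => ?_
        refine gapGen_mem_closure _ (fun h1 => ?_) (fun h1 j h2 h3 => ?_) fun h1 => ?_ <;>
        · simp only [Set.mem_ofPred_eq]
          split_ifs <;> omega
      rcases lt_trichotomy m s with h1 | rfl | h1
      · rw [gapGen_of_lt h1]
        have h2 := hgap m (by omega)
        rw [hw, mul_assoc] at h2
        exact gen_dvd_of_dvd_mul (by omega) (F := {j | j + 1 < m})
          (fun j hj => by simp only [Set.mem_ofPred_eq] at hj; omega)
          (hmem m (by rw [if_pos h1.le]))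
          (gen_dvd_of_dvd_seg_mul (by omega) (by omega) (by omega) (halfTwist_mem _ _) h2)
      · have hc : Commute (halfTwist n (m + 1) h) (altProd (gapGen n m (h + 1)) e m) :=
          commute_altProd fun i _ _ => halfTwist_commute_gapGen (by omega)
        have hd : halfTwist n m (h + 2) ∣ halfTwist n (m + 1) h * w := by
          refine halfTwist_dvd (by omega) fun i h2 h3 => ?_
          have h4 := hgap i (by omega)
          rw [hw, hc.eq, mul_assoc] at h4
          exact gen_dvd_of_dvd_mul (by omega) (F := {j | j + 1 < m})
            (fun j hj => by simp only [Set.mem_ofPred_eq] at hj; omega)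
            (hmem m (by rw [if_pos le_rfl])) h4
        obtain ⟨v, hv⟩ := hd
        rw [← halfTwist_mul_cross (by omega), mul_assoc] at hv
        rw [gapGen_self, br_mul_left_cancel hv]
        exact dvd_mul_right _ _
      · rw [gapGen_of_gt h1]
        have h2 := hgap (m + (h + 1)) (by omega)
        rw [hw, mul_assoc] at h2
        exact gen_dvd_of_dvd_mul (by omega) (F := {j | j + 1 < m + (h + 1)})
          (fun j hj => by simp only [Set.mem_ofPred_eq] at hj; omega)
          (hmem _ (by rw [if_neg (by omega)]))
          (gen_dvd_of_dvd_seg_mul (by omega) (by omega) (by omega) (halfTwist_mem _ _) h2)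
    · rw [mul_one, hw]
      exact dvd_mul_right _ _

theorem halfTwist_mem_letters {a k : ℕ} (ha : a + k ≤ n) :
    halfTwist n a k ∈ parabolicSubmonoid (CoxeterMatrix.A n) {i | τ i ∣ halfTwist n a k} :=
  mem_parabolicSubmonoid_of_seg (halfTwist_mem a k) fun _ h1 h2 => gen_dvd_halfTwist h1 h2 ha

/-- All letters of the half twist of the gap times a bipartite product divide this element. -/
theorem halfTwist_mul_altProd_mem_letters (hn : s + h + r + 2 = n) (e : ℕ) :
    halfTwist n (s + 1) h * altProd (gapGen n s (h + 1)) e (s + 1 + r) ∈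
      parabolicSubmonoid (CoxeterMatrix.A n)
        {i | τ i ∣ halfTwist n (s + 1) h * altProd (gapGen n s (h + 1)) e (s + 1 + r)} := by
  refine mul_mem (mem_parabolicSubmonoid_of_seg (halfTwist_mem _ _) fun i h1 h2 =>
    Dvd.dvd.mul_right (gen_dvd_halfTwist h1 h2 (by omega)) _) ?_
  refine altProd_induction (P := (· ∈ parabolicSubmonoid (CoxeterMatrix.A n) _)) (one_mem _)
    (fun _ _ => mul_mem) fun i hi hie => ?_
  have hd := gapGen_dvd_altProd (n := n) (s := s) (h := h + 1) hi hie
  rcases lt_trichotomy i s with h1 | rfl | h1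
  · refine mem_parabolicSubmonoid_of_seg (s := i) (k := 1) ?_ fun j h2 h3 =>
      gen_dvd_of_gapGen_dvd (by omega) (Or.inl ⟨by omega, by omega⟩) hd
    rw [gapGen_of_lt h1]
    exact gen_mem_segMonoid le_rfl (Nat.lt_succ_self i)
  · refine mem_parabolicSubmonoid_of_seg (s := i) (k := h + 1 + 1) ?_ fun j h2 h3 =>
      gen_dvd_of_gapGen_dvd (by omega) (Or.inr (Or.inl ⟨by omega, by omega, rfl⟩)) hd
    rw [gapGen_self]
    exact cross_mem _ _
  · refine mem_parabolicSubmonoid_of_seg (s := i + (h + 1)) (k := 1) ?_ fun j h2 h3 =>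
      gen_dvd_of_gapGen_dvd (by omega) (Or.inr (Or.inr ⟨h1, by omega⟩)) hd
    rw [gapGen_of_gt h1]
    exact gen_mem_segMonoid le_rfl (Nat.lt_succ_self _)

end Bipartite

end Gap

section Gap

variable {n : ℕ}

local notation "τ" => T (CoxeterMatrix.A n)
local notation "ℓ" => len (CoxeterMatrix.A n)
local notation "σ" => gen n
local notation "SqF" => IsSquareFree (CoxeterMatrix.A n)
local notation "Δ" => halfTwist n 0 n

/-! ### The permutations of half twists and bipartite products -/

theorem perm_gen {k : ℕ} (h : k < n) : perm n (σ k) = adj k := by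
  rw [gen_of_lt h, perm_T]

theorem perm_seg_apply {s k q : ℕ} {x : Br n} (hx : x ∈ segMonoid n s k) (h : q < s ∨ s + k < q) :
    perm n x q = q := by
  induction hx using Submonoid.closure_induction with
  | mem x hx =>
    obtain ⟨i, ⟨h1, h2⟩, rfl⟩ := hx
    rcases Nat.lt_or_ge i n with h3 | h3
    · rw [perm_gen h3, adj_of_ne (by omega) (by omega)]
    · rw [gen, dif_neg (by omega), map_one, Equiv.Perm.one_apply]
  | one => rw [map_one, Equiv.Perm.one_apply]
  | mul x y _ _ hx hy => rw [map_mul, Equiv.Perm.mul_apply, hy, hx]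

theorem perm_up_apply {s k q : ℕ} (hn : s + k ≤ n) (h1 : s ≤ q) (h2 : q ≤ s + k) :
    perm n (up n s k) q = if q = s + k then s else q + 1 := by
  induction k generalizing q with
  | zero => rw [if_pos (by omega), up, map_one, Equiv.Perm.one_apply]; omega
  | succ k ih =>
    rw [up, map_mul, Equiv.Perm.mul_apply, perm_gen (by omega), adj_apply]
    split_ifs with h3 h4 h5 h6 <;> try omega
    · rw [perm_seg_apply (up_mem _ _) (by omega)]; omega
    · rw [ih (by omega) (by omega) le_rfl, if_pos rfl]
    · rw [ih (by omega) h1 (by omega), if_neg h3]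

/-- The half twist reverses the order of its strands. -/
theorem perm_halfTwist_apply {s k q : ℕ} (hn : s + k ≤ n) (h1 : s ≤ q) (h2 : q ≤ s + k) :
    perm n (halfTwist n s k) q = 2 * s + k - q := by
  induction k with
  | zero => rw [halfTwist, map_one, Equiv.Perm.one_apply]; omega
  | succ k ih =>
    rw [halfTwist_succ_up, map_mul, Equiv.Perm.mul_apply]
    rcases Nat.lt_or_ge (s + k) q with h | h
    · rw [perm_seg_apply (halfTwist_mem _ _) (by omega), perm_up_apply hn h1 h2, if_pos (by omega)]
      omega
    · rw [ih (by omega) h, perm_up_apply hn (by omega) (by omega), if_neg (by omega)]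
      omega

theorem cross_succ (s g : ℕ) : cross n s (g + 1) = σ s * cross n (s + 1) g * σ s := by
  rw [cross, cross, up_succ', dn_succ']
  simp only [mul_assoc]

theorem perm_cross {s g : ℕ} (hn : s + g < n) :
    perm n (cross n s g) = Equiv.swap s (s + g + 1) := by
  induction g generalizing s with
  | zero =>
    simp only [cross, up, dn, one_mul, mul_one, add_zero]
    exact perm_gen hn
  | succ g ih =>
    rw [cross_succ, map_mul, map_mul, ih (by omega), perm_gen (by omega), adj,
      show s + 1 + g + 1 = s + (g + 1) + 1 by omega]
    ext p
    simp only [Equiv.Perm.mul_apply, Equiv.swap_apply_def]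
    split_ifs <;> omega

/-- The position of the `q`-th of the strands outside of the gap `{s + 1, …, s + k}`. -/
def pos (s k q : ℕ) : ℕ := if q ≤ s then q else q + k

theorem pos_ne_gap {s k i q : ℕ} (h1 : s < i) (h2 : i ≤ s + k) : pos s k q ≠ i := by
  unfold pos
  split_ifs <;> omega

theorem perm_gapGen {s k i : ℕ} (hn : s + k < n) (hi : pos s k i < n) :
    perm n (gapGen n s k i) = Equiv.swap (pos s k i) (pos s k (i + 1)) := by
  rcases lt_trichotomy i s with h | rfl | h
  · rw [gapGen_of_lt h, pos, pos, if_pos h.le, if_pos (Nat.succ_le_of_lt h), perm_gen (by omega)]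
    rfl
  · rw [gapGen_self, perm_cross hn, pos, pos, if_pos le_rfl, if_neg (by omega)]
    congr 1
    omega
  · rw [pos, if_neg (by omega)] at hi
    rw [gapGen_of_gt h, pos, pos, if_neg (by omega), if_neg (by omega), perm_gen hi]
    rw [adj]
    congr 1
    omega

theorem pos_injective (s k : ℕ) : Function.Injective (pos s k) := by
  intro p q h
  unfold pos at h
  split_ifs at h <;> omega

theorem perm_altProd_gap {s k m e i : ℕ} (hn : s + k + m ≤ n + s) (hn' : s + k < n)
    (h1 : s < i) (h2 : i ≤ s + k) : perm n (altProd (gapGen n s k) e m) i = i := by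
  refine altProd_induction (P := fun x => perm n x i = i) (by simp)
    (fun u v hu hv => by rw [map_mul, Equiv.Perm.mul_apply, hv, hu]) fun j hj _ => ?_
  have hp : pos s k j < n := by unfold pos; split_ifs <;> omega
  rw [perm_gapGen hn' hp, Equiv.swap_apply_of_ne_of_ne (pos_ne_gap h1 h2).symm
    (pos_ne_gap h1 h2).symm]

/-- The effect of a product of commuting transpositions `(i, i + 1)`, `i ≡ e`, `i < m`, on
`{0, …, m}`. -/
def bounce (m e q : ℕ) : ℕ := if q % 2 = e then (if q < m then q + 1 else q) else q - 1

theorem perm_altProd_pos {s k m e q : ℕ} (hn : s + k + m ≤ n + s) (hn' : s + k < n) (he : e < 2)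
    (hq : q ≤ m) : perm n (altProd (gapGen n s k) e m) (pos s k q) = pos s k (bounce m e q) := by
  have hfix : ∀ m q, m < q → s + k + m ≤ n + s →
      perm n (altProd (gapGen n s k) e m) (pos s k q) = pos s k q := by
    intro m q hmq hm
    refine altProd_induction (P := fun x => perm n x _ = _) (by simp)
      (fun u v hu hv => by rw [map_mul, Equiv.Perm.mul_apply, hv, hu]) fun j hj _ => ?_
    have hp : pos s k j < n := by unfold pos; split_ifs <;> omega
    rw [perm_gapGen hn' hp, Equiv.swap_apply_of_ne_of_ne
      ((pos_injective s k).ne (by omega)) ((pos_injective s k).ne (by omega))]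
  induction m generalizing q with
  | zero =>
    obtain rfl : q = 0 := by omega
    simp [altProd, bounce]
  | succ m ih =>
    rw [altProd, map_mul, Equiv.Perm.mul_apply]
    have hp : pos s k m < n := by unfold pos; split_ifs <;> omega
    split_ifs with hm
    · rw [perm_gapGen hn' hp]
      rcases lt_trichotomy q m with h | rfl | h
      · rw [Equiv.swap_apply_of_ne_of_ne
          ((pos_injective s k).ne (by omega)) ((pos_injective s k).ne (by omega)),
          ih (by omega) (by omega)]
        congr 1
        unfold bounce
        split_ifs <;> omega
      · rw [Equiv.swap_apply_left, hfix _ _ (by omega) (by omega)]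
        congr 1
        unfold bounce
        split_ifs <;> omega
      · obtain rfl : q = m + 1 := by omega
        rw [Equiv.swap_apply_right, ih (by omega) le_rfl]
        congr 1
        unfold bounce
        split_ifs <;> omega
    · rw [map_one, Equiv.Perm.one_apply]
      rcases Nat.lt_or_ge m q with h | h
      · rw [hfix _ _ h (by omega)]
        congr 1
        unfold bounce
        split_ifs <;> omega
      · rw [ih (by omega) h]
        congr 1
        unfold bounce
        split_ifs <;> omega

/-- The folding of a line onto `{0, …, m}` by reflections at its ends, on a sufficiently long
interval. It turns the bouncing motion into a uniform motion. -/
def fold (m y : ℕ) : ℕ :=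
  if y ≤ m then y else if y ≤ 2 * m + 1 then 2 * m + 1 - y else y - (2 * m + 2)

theorem bounce_fold {m e y : ℕ} (hy : y < 3 * m + 2) (h : y % 2 = e) :
    bounce m e (fold m y) = fold m (y + 1) := by
  unfold bounce fold
  split_ifs <;> omega

theorem fold_le {m y : ℕ} (hy : y ≤ 3 * m + 2) : fold m y ≤ m := by
  unfold fold
  split_ifs <;> omega

theorem perm_bipartite_pow_fold {s k m e e' y j : ℕ} (hn : s + k + m ≤ n + s) (hn' : s + k < n)
    (he : e + e' = 1) (hy : y % 2 = e') (hj : y + 2 * j ≤ 3 * m + 2) :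
    perm n ((altProd (gapGen n s k) e m * altProd (gapGen n s k) e' m) ^ j)
      (pos s k (fold m y)) = pos s k (fold m (y + 2 * j)) := by
  induction j with
  | zero => simp
  | succ j ih =>
    rw [pow_succ', map_mul, Equiv.Perm.mul_apply, ih (by omega), map_mul, Equiv.Perm.mul_apply,
      perm_altProd_pos hn hn' (by omega) (fold_le (by omega)), bounce_fold (by omega) (by omega),
      perm_altProd_pos hn hn' (by omega) (fold_le (by omega)), bounce_fold (by omega) (by omega)]
    congr 2

/-- For `m + 1` even, `(m + 1) / 2` bipartite rotations reverse the order of the strands outside of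
the gap. -/
theorem perm_bipartite_pow {s k m e e' q j : ℕ} (hn : s + k + m ≤ n + s) (hn' : s + k < n)
    (he : e + e' = 1) (hm : m + 1 = 2 * j) (hq : q ≤ m) :
    perm n ((altProd (gapGen n s k) e m * altProd (gapGen n s k) e' m) ^ j) (pos s k q) =
      pos s k (m - q) := by
  by_cases h : q % 2 = e'
  · have := perm_bipartite_pow_fold (y := q) (j := j) hn hn' he h (by omega)
    rw [show fold m q = q by unfold fold; split_ifs; omega] at this
    rw [this]
    congr 1
    unfold fold
    split_ifs <;> omega
  · have := perm_bipartite_pow_fold (y := 2 * m + 1 - q) (j := j) hn hn' he (by omega) (by omega)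
    rw [show fold m (2 * m + 1 - q) = q by unfold fold; split_ifs <;> omega] at this
    rw [this]
    congr 1
    unfold fold
    split_ifs <;> omega

/-! ### The two bipartite products generate a dihedral image -/

section Main

variable {s h r : ℕ}

local notation "𝐀" => altProd (gapGen n s (h + 1)) 0 (s + 1 + r)
local notation "𝐁" => altProd (gapGen n s (h + 1)) 1 (s + 1 + r)
local notation "𝐆" => halfTwist n (s + 1) h

theorem halfTwist_commute_altProd (hn : s + h + r + 2 = n) (e m : ℕ) :
    Commute 𝐆 (altProd (gapGen n s (h + 1)) e m) :=
  commute_altProd fun _ _ _ => halfTwist_commute_gapGen (by omega)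

/-- The full rotation does not depend on the order of the two bipartite products, since the full twist
is central. -/
theorem bipartite_pow_comm (hn : s + h + r + 2 = n) :
    (𝐀 * 𝐁) ^ (s + r + 2) = (𝐁 * 𝐀) ^ (s + r + 2) := by
  have h1 := halfTwist_sq_mul_bipartite_pow hn
  have h2 := (halfTwist_commute_altProd hn 0 (s + 1 + r)).pow_left 2
  have h3 := (commute_halfTwist_sq (n := n) 𝐀).eq
  rw [← h1, mul_assoc, ← mul_assoc 𝐀, ← h2.eq, mul_assoc] at h3
  have h4 := br_mul_left_cancel h3
  rw [mul_pow_mul] at h4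
  exact (br_mul_left_cancel h4).symm

theorem len_bipartite (hn : s + h + r + 2 = n) :
    2 * ℓ 𝐆 + (s + r + 2) * (ℓ 𝐀 + ℓ 𝐁) = 2 * ℓ Δ := by
  have := congrArg ℓ (halfTwist_sq_mul_bipartite_pow hn)
  rwa [len_mul, len_pow, len_pow, len_pow, len_mul] at this

theorem len_bipartite_pos (hn : s + h + r + 2 = n) : 0 < ℓ 𝐀 + ℓ 𝐁 := by
  have hpos : ∀ e, s % 2 = e → 0 < ℓ (altProd (gapGen n s (h + 1)) e (s + 1 + r)) := by
    intro e he
    obtain ⟨w, hw⟩ := gapGen_dvd_altProd (n := n) (s := s) (h := h + 1) (i := s) (m := s + 1 + r)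
      (by omega) he
    rw [hw, gapGen_self, cross, up_succ', len_mul, len_mul, len_mul, len_gen (by omega)]
    omega
  rcases Nat.mod_two_eq_zero_or_one s with h0 | h0
  · have := hpos 0 h0; omega
  · have := hpos 1 h0; omega

/-- In the reflection symmetric case already half of the full rotation is a half twist, up to the
half twist of the gap. -/
theorem halfTwist_mul_bipartite_pow_of_symm (hn : s + h + s + 2 = n) {e e' : ℕ} (he : e + e' = 1) :
    𝐆 * (altProd (gapGen n s (h + 1)) e (s + 1 + s) *
      altProd (gapGen n s (h + 1)) e' (s + 1 + s)) ^ (s + 1) = Δ := by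
  set X := 𝐆 * (altProd (gapGen n s (h + 1)) e (s + 1 + s) *
      altProd (gapGen n s (h + 1)) e' (s + 1 + s)) ^ (s + 1) with hX
  have hperm : perm n X = perm n Δ := by
    ext i
    rcases Nat.lt_or_ge n i with h0 | h0
    · rw [perm_eq, perm_eq, permHom_of_gt _ h0, permHom_of_gt _ h0]
    rw [perm_halfTwist_apply (by omega) (by omega) (by omega), hX, map_mul, Equiv.Perm.mul_apply]
    by_cases hi : s < i ∧ i ≤ s + (h + 1)
    · have hfix : ∀ j : ℕ, perm n ((altProd (gapGen n s (h + 1)) e (s + 1 + s) *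
          altProd (gapGen n s (h + 1)) e' (s + 1 + s)) ^ j) i = i := by
        intro j
        induction j with
        | zero => simp
        | succ j ih =>
          rw [pow_succ, map_mul, map_mul, Equiv.Perm.mul_apply, Equiv.Perm.mul_apply,
            perm_altProd_gap (by omega) (by omega) hi.1 hi.2,
            perm_altProd_gap (by omega) (by omega) hi.1 hi.2, ih]
      rw [hfix, perm_halfTwist_apply (by omega) (by omega) (by omega)]
      omega
    · obtain ⟨q, hq, rfl⟩ : ∃ q, q ≤ s + 1 + s ∧ i = pos s (h + 1) q := by
        rcases Nat.lt_or_ge s i with h1 | h1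
        · exact ⟨i - (h + 1), by omega, by unfold pos; split_ifs <;> omega⟩
        · exact ⟨i, by omega, (if_pos h1).symm⟩
      rw [perm_bipartite_pow (by omega) (by omega) he (by omega) hq,
        perm_seg_apply (halfTwist_mem _ _) (by unfold pos; split_ifs <;> omega)]
      unfold pos
      split_ifs <;> omega
  have hlen : ℓ X = ℓ Δ := by
    have h1 := len_bipartite (n := n) (r := s) hn
    have h2 : ℓ (altProd (gapGen n s (h + 1)) e (s + 1 + s)) +
        ℓ (altProd (gapGen n s (h + 1)) e' (s + 1 + s)) =
        ℓ (altProd (gapGen n s (h + 1)) 0 (s + 1 + s)) +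
        ℓ (altProd (gapGen n s (h + 1)) 1 (s + 1 + s)) := by
      rcases Nat.eq_zero_or_pos e with rfl | h3
      · obtain rfl : e' = 1 := by omega
        rfl
      · obtain ⟨rfl, rfl⟩ : e = 1 ∧ e' = 0 := by omega
        rw [add_comm]
    rw [hX, len_mul, len_pow, len_mul, h2]
    have h4 : s + s + 2 = 2 * (s + 1) := by ring
    rw [h4, mul_assoc] at h1
    omega
  have hr := isSquareFree_iff_isRed.1 (halfTwist_squareFree (n := n))
  refine IsRed.eq_of_perm_eq ?_ hr hperm
  rw [IsRed, hperm, hlen]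
  exact hr

theorem halfTwist_mul_bipartite_pow_of_eq (hn : s + h + r + 2 = n) (hsr : s = r) {e e' : ℕ}
    (he : e + e' = 1) :
    𝐆 * (altProd (gapGen n s (h + 1)) e (s + 1 + r) *
      altProd (gapGen n s (h + 1)) e' (s + 1 + r)) ^ (s + 1) = Δ := by
  subst hsr
  exact halfTwist_mul_bipartite_pow_of_symm hn he

/-- Half of the off-diagonal entry of the dihedral Coxeter matrix. -/
def halfEntry (s r : ℕ) : ℕ := if s = r then s + 1 else s + r + 2

/-- If the gap is not symmetric, the half twist does not preserve it. -/
theorem halfTwist_ne_of_ne (hn : s + h + r + 2 = n) (hsr : s ≠ r) {z : Br n}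
    (hz : ∀ i, s < i → i ≤ s + (h + 1) → perm n z i = i) : 𝐆 * z ≠ Δ := by
  intro hΔ
  have key : ∀ i, s < i → i ≤ s + (h + 1) → s < n - i ∧ n - i ≤ s + (h + 1) := by
    intro i h1 h2
    have h3 := congrArg (fun x => perm n x i) hΔ
    simp only [map_mul, Equiv.Perm.mul_apply] at h3
    rw [hz i h1 h2, perm_halfTwist_apply (by omega) (by omega) (by omega),
      perm_halfTwist_apply (by omega) (by omega) (by omega)] at h3
    omega
  have h1 := key (s + 1) (by omega) (by omega)
  have h2 := key (s + (h + 1)) (by omega) (by omega)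
  omega

theorem mem_braidSet_halfEntry (hn : s + h + r + 2 = n) :
    2 * halfEntry s r ∈ braidSet 𝐀 𝐁 := by
  refine ⟨by unfold halfEntry; split_ifs <;> omega, ?_⟩
  rw [brd_two_mul, brd_two_mul, halfEntry]
  split_ifs with hsr
  · refine br_mul_left_cancel (x := 𝐆) ?_
    rw [halfTwist_mul_bipartite_pow_of_eq hn hsr rfl, halfTwist_mul_bipartite_pow_of_eq hn hsr rfl]
  · exact bipartite_pow_comm hn

/-- An element with a braid relation is divisible by both bipartite products, hence, up to the half
twist of the gap, by the half twist; this bounds its length from below. -/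
theorem halfTwist_dvd_of_mem_braidSet (hn : s + h + r + 2 = n) {k : ℕ} (hk : k ∈ braidSet 𝐀 𝐁) :
    Δ ∣ 𝐆 * brd 𝐀 𝐁 k ∧ 2 * ℓ (brd 𝐀 𝐁 k) = k * (ℓ 𝐀 + ℓ 𝐁) := by
  obtain ⟨h0, hk⟩ := hk
  constructor
  · refine halfTwist_dvd_of_forall_gapGen_dvd hn fun i hi => ?_
    obtain ⟨j, rfl⟩ : ∃ j, k = j + 1 := ⟨k - 1, by omega⟩
    rcases Nat.mod_two_eq_zero_or_one i with h1 | h1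
    · rw [brd_succ]
      exact Dvd.dvd.mul_right (gapGen_dvd_altProd hi h1) _
    · rw [hk, brd_succ]
      exact Dvd.dvd.mul_right (gapGen_dvd_altProd hi h1) _
  · have h1 := congrArg ℓ hk
    simp only [brd, len_mul, len_pow] at h1 ⊢
    rcases Nat.even_or_odd' k with ⟨j, rfl | rfl⟩
    · rw [show 2 * j / 2 = j by omega, show 2 * j % 2 = 0 by omega]
      ring
    · rw [show (2 * j + 1) / 2 = j by omega, show (2 * j + 1) % 2 = 1 by omega] at h1 ⊢
      have h2 : ℓ 𝐀 = ℓ 𝐁 := by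
        rw [add_comm (ℓ 𝐁) (ℓ 𝐀)] at h1
        omega
      rw [h2]
      ring

theorem le_of_mem_braidSet (hn : s + h + r + 2 = n) {k : ℕ} (hk : k ∈ braidSet 𝐀 𝐁) :
    s + r + 2 ≤ k := by
  obtain ⟨⟨w, hw⟩, h2⟩ := halfTwist_dvd_of_mem_braidSet hn hk
  have h3 := congrArg ℓ hw
  rw [len_mul, len_mul] at h3
  have h4 := len_bipartite hn
  have h5 := len_bipartite_pos hn
  refine Nat.le_of_mul_le_mul_right (c := ℓ 𝐀 + ℓ 𝐁) ?_ h5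
  omega

theorem perm_brd_gap (hn : s + h + r + 2 = n) {i : ℕ} (h1 : s < i) (h2 : i ≤ s + (h + 1))
    (k : ℕ) : perm n (brd 𝐀 𝐁 k) i = i ∧ perm n (brd 𝐁 𝐀 k) i = i := by
  induction k with
  | zero => simp
  | succ k ih =>
    rw [brd_succ, brd_succ, map_mul, map_mul, Equiv.Perm.mul_apply, Equiv.Perm.mul_apply, ih.1,
      ih.2]
    exact ⟨perm_altProd_gap (by omega) (by omega) h1 h2,
      perm_altProd_gap (by omega) (by omega) h1 h2⟩

/-- The minimal length of a braid relation between the two bipartite products. -/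
theorem isLeast_braidSet (hn : s + h + r + 2 = n) :
    IsLeast (braidSet 𝐀 𝐁) (2 * halfEntry s r) := by
  refine ⟨mem_braidSet_halfEntry hn, fun k hk => ?_⟩
  have hle := le_of_mem_braidSet hn hk
  by_cases hsr : s = r
  · rw [halfEntry, if_pos hsr]
    omega
  · have hmem := mem_braidSet_halfEntry hn
    rw [halfEntry, if_neg hsr] at hmem ⊢
    by_contra hlt
    have hsub := le_of_mem_braidSet hn (sub_mem_braidSet hk hmem (by omega))
    obtain rfl : k = s + r + 2 := by omega
    -- for `k = |J|` the lengths force the half twist to preserve the gap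
    obtain ⟨⟨w, hw⟩, h2⟩ := halfTwist_dvd_of_mem_braidSet hn hk
    have h3 := congrArg ℓ hw
    rw [len_mul, len_mul] at h3
    have h4 := len_bipartite hn
    have hw1 : w = 1 := eq_one_of_len_eq_zero _ (by omega)
    rw [hw1, mul_one] at hw
    exact halfTwist_ne_of_ne hn hsr (fun i h5 h6 => (perm_brd_gap hn h5 h6 _).1) hw

/-- The elements `T_{w_∘}` and `T_{s w_∘}` of the dihedral Artin monoid are mapped to parabolic
elements. -/
theorem brd_mem_parabolicElements (hn : s + h + r + 2 = n) :
    brd 𝐀 𝐁 (2 * halfEntry s r) ∈ parabolicElements (CoxeterMatrix.A n) Set.univ ∧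
    brd 𝐀 𝐁 (2 * halfEntry s r - 1) ∈ parabolicElements (CoxeterMatrix.A n) Set.univ ∧
    brd 𝐁 𝐀 (2 * halfEntry s r - 1) ∈ parabolicElements (CoxeterMatrix.A n) Set.univ := by
  have hn0 : 0 < n := by omega
  have hm := (mem_braidSet_halfEntry hn).2
  have hA := brd_succ 𝐀 𝐁 (2 * halfEntry s r - 1)
  have hB := brd_succ 𝐁 𝐀 (2 * halfEntry s r - 1)
  have hm1 : 2 * halfEntry s r - 1 + 1 = 2 * halfEntry s r := by
    have := (mem_braidSet_halfEntry hn).1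
    omega
  rw [hm1] at hA hB
  rw [← hm] at hB
  by_cases hsr : s = r
  · have hG : 𝐆 * brd 𝐀 𝐁 (2 * halfEntry s r) = Δ := by
      rw [brd_two_mul, halfEntry, if_pos hsr, halfTwist_mul_bipartite_pow_of_eq hn hsr rfl]
    refine ⟨mem_parabolicElements hn0 (halfTwist_mem_letters (by omega)) hG, ?_, ?_⟩
    · refine mem_parabolicElements hn0 (halfTwist_mul_altProd_mem_letters hn 1) ?_
      rw [mul_assoc, ← hB, hG]
    · refine mem_parabolicElements hn0 (halfTwist_mul_altProd_mem_letters hn 0) ?_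
      rw [mul_assoc, ← hA, hG]
  · have hX : brd 𝐀 𝐁 (2 * halfEntry s r) = (𝐀 * 𝐁) ^ (s + r + 2) := by
      rw [brd_two_mul, halfEntry, if_neg hsr]
    have hGX : Commute 𝐆 ((𝐀 * 𝐁) ^ (s + r + 2)) :=
      ((halfTwist_commute_altProd hn 0 _).mul_right (halfTwist_commute_altProd hn 1 _)).pow_right _
    have hdvd : ∀ a, a + h ≤ n → halfTwist n a h ∣ Δ := fun a ha =>
      halfTwist_dvd ha fun i _ h2 => gen_dvd_halfTwist (by omega) (by omega) (by omega)
    obtain ⟨Z, hZ⟩ := hdvd (s + 1) (by omega)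
    -- the complement of the half twist on the reflected gap
    obtain ⟨Z', hZ'⟩ := hdvd (r + 1) (by omega)
    have hZ2 : Z' * 𝐆 = Δ := by
      have h1 := halfTwist_mul_halfTwist (n := n) (s := s + 1) (k := h) (by omega)
      rw [show n - (s + 1) - h = r + 1 by omega] at h1
      refine br_mul_left_cancel (x := halfTwist n (r + 1) h) ?_
      rw [← mul_assoc, ← hZ', h1]
    have hfull : 𝐆 * (𝐀 * 𝐁) ^ (s + r + 2) = Δ * Z' := by
      refine br_mul_right_cancel (x := 𝐆) ?_
      rw [mul_assoc, ← hGX.eq, ← mul_assoc, ← sq, halfTwist_sq_mul_bipartite_pow hn, mul_assoc,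
        hZ2, sq]
    have hZ'mem := mem_parabolicElements hn0 (halfTwist_mem_letters (by omega)) hZ'.symm
    have hcase : ∀ (e : ℕ) (Y : Br n),
        (𝐀 * 𝐁) ^ (s + r + 2) = altProd (gapGen n s (h + 1)) e (s + 1 + r) * Y →
        Y ∈ parabolicElements (CoxeterMatrix.A n) Set.univ := by
      intro e Y hY
      obtain ⟨V, hV⟩ := halfTwist_mul_altProd_dvd hn e (s + 1 + r) le_rfl
      have hYV : 𝐆 * altProd (gapGen n s (h + 1)) e (s + 1 + r) * Y =
          𝐆 * altProd (gapGen n s (h + 1)) e (s + 1 + r) * (V * Z') := by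
        rw [mul_assoc, ← hY, hfull, ← mul_assoc _ V, ← hV]
      rw [br_mul_left_cancel hYV]
      exact mul_mem (mem_parabolicElements hn0 (halfTwist_mul_altProd_mem_letters hn e) hV.symm)
        hZ'mem
    refine ⟨?_, hcase 1 _ (by rw [← hX, hB]), hcase 0 _ (by rw [← hX, hA])⟩
    rw [hX]
    rw [hZ, mul_assoc] at hfull
    rw [br_mul_left_cancel hfull]
    exact mul_mem (mem_parabolicElements hn0 (halfTwist_mem_letters (by omega)) hZ.symm) hZ'mem

end Main

end Gap

/-! ### The dihedral Artin monoid -/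

section Dihedral

variable {m : ℕ}

local notation "D" => dihedral (2 * m)

theorem dihedral_apply (hm : 0 < m) {i j : Fin 2} (h : i ≠ j) : D i j = 2 * m := by
  change (if i = j then 1 else 2 * m - 2 + 2) = 2 * m
  rw [if_neg h]
  omega

theorem brd_T_dihedral (hm : 0 < m) {i j : Fin 2} (h : i ≠ j) :
    brd (T D i) (T D j) (2 * m) = brd (T D j) (T D i) (2 * m) := by
  have := brd_T D i j h (by rw [dihedral_apply hm h]; omega)
  rwa [dihedral_apply hm h] at this

/-- Square free elements of a dihedral Artin monoid are alternating products. -/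
theorem exists_eq_brd {x : ArtinMonoid D} (hx : IsSquareFree D x) :
    ∃ i j : Fin 2, i ≠ j ∧ x = brd (T D i) (T D j) (len D x) := by
  induction x using artin_induction with
  | one => exact ⟨0, 1, by decide, by rw [len_one, brd_zero]⟩
  | mul i x ih =>
    obtain ⟨i', j', hne, he⟩ := ih hx.of_mul.2
    rw [len_mul, len_T, add_comm]
    rcases Nat.eq_zero_or_pos (len D x) with h0 | h0
    · refine ⟨i, i + 1, by fin_cases i <;> decide, ?_⟩
      rw [eq_one_of_len_eq_zero D h0, len_one, brd_succ, brd_zero]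
    · obtain ⟨k, hk⟩ : ∃ k, len D x = k + 1 := ⟨len D x - 1, by omega⟩
      have hi : i ≠ i' := by
        rintro rfl
        rw [hk, brd_succ] at he
        rw [he] at hx
        exact not_squareFree_T_mul_T i _ hx
      obtain rfl : i = j' := by omega
      refine ⟨i, i', hi, ?_⟩
      rw [brd_succ, ← he]

theorem len_le_of_squareFree (hm : 0 < m) {x : ArtinMonoid D} (hx : IsSquareFree D x) :
    len D x ≤ 2 * m := by
  obtain ⟨i, j, hne, he⟩ := exists_eq_brd hx
  by_contra hlt
  obtain ⟨l, hl⟩ : ∃ l, len D x = 2 * m + 1 + l := ⟨len D x - (2 * m + 1), by omega⟩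
  rw [hl, brd_add] at he
  rw [he] at hx
  have h1 := hx.of_mul.1
  have h2 := brd_succ (T D i) (T D j) (2 * m - 1)
  rw [show 2 * m - 1 + 1 = 2 * m by omega] at h2
  rw [brd_succ, ← brd_T_dihedral hm hne, h2] at h1
  exact not_squareFree_T_mul_T _ _ h1

theorem coxLen_le (hm : 0 < m) (w : (dihedral (2 * m)).Group) : coxLen D w ≤ 2 * m := by
  rw [← len_sqfLift]
  exact len_le_of_squareFree hm (sqfLift_squareFree w)

theorem isFiniteType_univ (hm : 0 < m) : IsFiniteType D Set.univ := by
  have hfin : (Set.range fun p : Fin 2 × Fin 2 × Fin (2 * m + 1) =>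
      toCoxeter D (brd (T D p.1) (T D p.2.1) p.2.2)).Finite := Set.finite_range _
  refine hfin.subset fun w _ => ?_
  have hs := sqfLift_squareFree w
  obtain ⟨i, j, -, he⟩ := exists_eq_brd hs
  refine ⟨⟨i, j, ⟨_, Nat.lt_succ_of_le (len_le_of_squareFree hm hs)⟩⟩, ?_⟩
  dsimp only
  rw [← he, toCoxeter_sqfLift]

/-- The product of the two simple reflections has the expected order. -/
theorem simple_mul_simple_pow_ne_one (hm : 0 < m) {k : ℕ} (hk : 0 < k) (hk' : k < 2 * m) :
    ((dihedral (2 * m)).simple 0 * (dihedral (2 * m)).simple 1) ^ k ≠ 1 := by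
  intro he
  let f : Fin 2 → DihedralGroup (2 * m) := fun i => DihedralGroup.sr ((i : ℕ) : ZMod (2 * m))
  have hl : (dihedral (2 * m)).IsLiftable f := by
    intro i j
    by_cases hij : i = j
    · subst hij
      simp [f]
    · rw [dihedral_apply hm hij, DihedralGroup.sr_mul_sr, DihedralGroup.r_pow]
      simp only [DihedralGroup.one_def, DihedralGroup.r.injEq]
      rw [ZMod.natCast_self, mul_zero]
  have h1 := congrArg ((dihedral (2 * m)).toCoxeterSystem.lift ⟨f, hl⟩) he
  rw [map_pow, map_mul, map_one, ← CoxeterMatrix.toCoxeterSystem_simple,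
    CoxeterSystem.lift_apply_simple, CoxeterSystem.lift_apply_simple,
    DihedralGroup.sr_mul_sr, DihedralGroup.r_pow] at h1
  simp only [DihedralGroup.one_def, DihedralGroup.r.injEq, Fin.isValue, Fin.val_one, Fin.val_zero,
    Nat.cast_one, Nat.cast_zero, sub_zero, one_mul] at h1
  rw [ZMod.natCast_eq_zero_iff] at h1
  exact absurd (Nat.le_of_dvd hk h1) (by omega)

theorem coxLen_brd (hm : 0 < m) :
    coxLen D (toCoxeter D (brd (T D 0) (T D 1) (2 * m))) = 2 * m := by
  set v := toCoxeter D (brd (T D 0) (T D 1) (2 * m)) with hv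
  refine le_antisymm (coxLen_le hm _) ?_
  by_contra hlt
  obtain ⟨i, j, hne, he⟩ := exists_eq_brd (sqfLift_squareFree v)
  have hv' := congrArg (toCoxeter D) he
  rw [toCoxeter_sqfLift, len_sqfLift] at hv'
  have hpar := (D).toCoxeterSystem.lengthParity_eq_ofAdd_length v
  have hpar2 : (D).toCoxeterSystem.lengthParity v = 1 := by
    rw [hv, brd_two_mul, map_pow, map_mul, toCoxeter_T, toCoxeter_T, map_pow, map_mul,
      ← CoxeterMatrix.toCoxeterSystem_simple, CoxeterSystem.lengthParity_simple,
      CoxeterSystem.lengthParity_simple]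
    have h2 : (Multiplicative.ofAdd (1 : ZMod 2)) * Multiplicative.ofAdd (1 : ZMod 2) = 1 := by
      decide
    rw [h2, one_pow]
  rw [hpar2] at hpar
  have heven : 2 ∣ coxLen D v := by
    rw [← ZMod.natCast_eq_zero_iff]
    exact (Multiplicative.ofAdd.injective hpar).symm
  obtain ⟨k, hk⟩ := heven
  rw [hk, brd_two_mul, map_pow, map_mul, toCoxeter_T, toCoxeter_T, hv, brd_two_mul, map_pow,
    map_mul, toCoxeter_T, toCoxeter_T] at hv'
  rw [hk] at hlt
  have hinv : ∀ i, ((dihedral (2 * m)).simple i)⁻¹ = (dihedral (2 * m)).simple i := by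
    intro i
    rw [← CoxeterMatrix.toCoxeterSystem_simple, CoxeterSystem.inv_simple]
  have hij : i = 0 ∧ j = 1 ∨ i = 1 ∧ j = 0 := by omega
  rcases hij with ⟨rfl, rfl⟩ | ⟨rfl, rfl⟩
  · refine simple_mul_simple_pow_ne_one (m := m) hm (k := m - k) (by omega) (by omega) ?_
    have hadd := pow_add ((dihedral (2 * m)).simple 0 * (dihedral (2 * m)).simple 1) k (m - k)
    rw [show k + (m - k) = m by omega, hv'] at hadd
    exact mul_eq_left.1 hadd.symm
  · refine simple_mul_simple_pow_ne_one (m := m) hm (k := m + k) (by omega) (by omega) ?_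
    have h10 : (dihedral (2 * m)).simple 1 * (dihedral (2 * m)).simple 0 =
        ((dihedral (2 * m)).simple 0 * (dihedral (2 * m)).simple 1)⁻¹ := by
      rw [mul_inv_rev, hinv, hinv]
    rw [pow_add, hv', h10, inv_pow, inv_mul_cancel]

theorem longest_mem {B : Type*} (M : CoxeterMatrix B) (J : Set B) :
    longest M J ∈ parabolicSubgroup M J := by
  unfold longest
  split_ifs with h
  · exact h.choose_spec.1
  · exact one_mem _

theorem coxLen_longest (hm : 0 < m) : coxLen D (longest D Set.univ) = 2 * m := by
  have hmem : ∀ w : (dihedral (2 * m)).Group, w ∈ parabolicSubgroup D Set.univ := by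
    intro w
    rw [parabolicSubgroup, Set.image_univ]
    have := (D).toCoxeterSystem.subgroup_closure_range_simple
    rw [CoxeterMatrix.toCoxeterSystem_simple] at this
    rw [this]
    trivial
  have hex : ∃ w ∈ parabolicSubgroup D Set.univ,
      ∀ u ∈ parabolicSubgroup D Set.univ, coxLen D u ≤ coxLen D w :=
    ⟨_, hmem _, fun u _ => (coxLen_le hm u).trans (coxLen_brd hm).ge⟩
  refine le_antisymm (coxLen_le hm _) ?_
  rw [longest, dif_pos hex]
  have := hex.choose_spec.2 _ (hmem (toCoxeter D (brd (T D 0) (T D 1) (2 * m))))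
  rwa [coxLen_brd hm] at this

theorem longest_mul_self (hm : 0 < m) : longest D Set.univ * longest D Set.univ = 1 := by
  obtain ⟨i, j, hne, he⟩ := exists_eq_brd (sqfLift_squareFree (longest D Set.univ))
  rw [len_sqfLift, coxLen_longest hm, brd_two_mul] at he
  have h := congrArg (toCoxeter D) he
  rw [toCoxeter_sqfLift, map_pow, map_mul, toCoxeter_T, toCoxeter_T] at h
  have h2 := (D).toCoxeterSystem.simple_mul_simple_pow i j
  rw [dihedral_apply hm hne, CoxeterMatrix.toCoxeterSystem_simple] at h2
  rw [h, ← pow_add, ← two_mul, h2]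

theorem eq_one_or_eq_simple {B : Type*} (M : CoxeterMatrix B) {J : Set B} {i : B}
    (hJ : ∀ j ∈ J, j = i) {w : M.Group} (hw : w ∈ parabolicSubgroup M J) :
    w = 1 ∨ w = M.simple i := by
  have hi : M.simple i * M.simple i = 1 := M.toCoxeterSystem.simple_mul_simple_self i
  induction hw using Subgroup.closure_induction with
  | mem w hw =>
    obtain ⟨j, hj, rfl⟩ := hw
    rw [hJ j hj]
    exact Or.inr rfl
  | one => exact Or.inl rfl
  | mul u v _ _ hu hv =>
    rcases hu with rfl | rfl <;> rcases hv with rfl | rfl <;> simp [hi]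
  | inv u _ hu =>
    rcases hu with rfl | rfl
    · simp
    · exact Or.inr (inv_eq_of_mul_eq_one_left hi)

theorem component_eq_univ (hm : 1 < m) {C : Set (Fin 2)} (hC : IsComponent D Set.univ C) :
    C = Set.univ := by
  obtain ⟨c, rfl⟩ := hC
  obtain ⟨v, hv⟩ := c.nonempty_supp
  ext i
  simp only [Set.mem_univ, iff_true, Set.mem_image]
  refine ⟨⟨i, trivial⟩, ?_, rfl⟩
  by_cases h : (⟨i, trivial⟩ : (Set.univ : Set (Fin 2))) = v
  · rw [h]; exact hv
  · have hne : i ≠ v := fun e => h (Subtype.ext e)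
    have hadj : ((coxeterGraph D).induce Set.univ).Adj ⟨i, trivial⟩ v := by
      refine ⟨hne, ?_⟩
      change D i v ≠ 2
      rw [dihedral_apply (by omega) hne]
      omega
    exact (SimpleGraph.ConnectedComponent.sound hadj.reachable).trans hv

/-- The generators of the monoid of parabolic elements of a dihedral Artin monoid have length `0`,
`2m - 1` or `2m`. -/
theorem len_parabolic (hm : 0 < m) {C J : Set (Fin 2)} (hC : IsComponent D Set.univ C)
    (hJ : J ⊆ C) :
    len D (sqfLift D (longest D J * longest D C)) = 0 ∨
      len D (sqfLift D (longest D J * longest D C)) = 2 * m - 1 ∨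
      len D (sqfLift D (longest D J * longest D C)) = 2 * m := by
  rcases Nat.lt_or_ge 1 m with h1 | h1
  · obtain rfl := component_eq_univ h1 hC
    rw [len_sqfLift]
    have hsingle : ∀ i : Fin 2, (∀ j ∈ J, j = i) →
        coxLen D (longest D J * longest D Set.univ) = 2 * m - 1 ∨
        coxLen D (longest D J * longest D Set.univ) = 2 * m := by
      intro i hi
      rcases eq_one_or_eq_simple D hi (longest_mem D J) with h | h
      · rw [h, one_mul, coxLen_longest hm]
        exact Or.inr rfl
      · have h2 := coxLen_le hm (longest D J * longest D Set.univ)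
        have h3 := coxLen_longest hm
        rw [h] at h2 ⊢
        have h4 := (D).toCoxeterSystem.length_simple_mul (longest D Set.univ) i
        rw [CoxeterMatrix.toCoxeterSystem_simple] at h4
        unfold coxLen at *
        omega
    by_cases h0 : 0 ∈ J
    · by_cases h2 : 1 ∈ J
      · have hu : J = Set.univ := by
          ext i
          fin_cases i <;> simpa
        left
        rw [hu, longest_mul_self hm]
        exact (D).toCoxeterSystem.length_one
      · exact Or.inr (hsingle 0 fun j hj => by
          fin_cases j
          · rfl
          · exact absurd hj h2)
    · exact Or.inr (hsingle 1 fun j hj => by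
        fin_cases j
        · exact absurd hj h0
        · rfl)
  · have := len_le_of_squareFree hm (sqfLift_squareFree (longest D J * longest D C))
    omega

end Dihedral

section Translation

variable {n : ℕ}

local notation "τ" => T (CoxeterMatrix.A n)
local notation "ℓ" => len (CoxeterMatrix.A n)
local notation "σ" => gen n
local notation "SqF" => IsSquareFree (CoxeterMatrix.A n)
local notation "Δ" => halfTwist n 0 n

/-! ### Supports -/

/-- The homomorphism to `(ℕ, *)` detecting the letter `i`. -/
theorem exists_letter_hom (i : Fin n) :
    ∃ φ : Br n →* ℕ, φ (τ i) = 0 ∧ ∀ j, j ≠ i → φ (τ j) = 1 := by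
  classical
  obtain ⟨φ, hφ⟩ := exists_hom (n := n) (N := ℕ) (fun j => if j = i then 0 else 1)
    (fun j k _ => by split_ifs <;> rfl) (fun j k _ => mul_comm _ _)
  exact ⟨φ, by rw [hφ, if_pos rfl], fun j hj => by rw [hφ, if_neg hj]⟩

/-- The letters occurring in the words for a positive braid belong to its support. -/
theorem mem_supp {i : Fin n} {x : Br n} (h : ∀ φ : Br n →* ℕ, φ (τ i) = 0 → φ x = 0) :
    i ∈ supp (CoxeterMatrix.A n) x := by
  simp only [supp, Set.mem_iInter]
  intro J hJ
  by_contra hi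
  obtain ⟨φ, h1, h2⟩ := exists_letter_hom i
  have h3 : ∀ y ∈ parabolicSubmonoid (CoxeterMatrix.A n) J, φ y = 1 := by
    intro y hy
    induction hy using Submonoid.closure_induction with
    | mem y hy =>
      obtain ⟨j, hj, rfl⟩ := hy
      exact h2 j fun e => hi (e ▸ hj)
    | one => exact map_one φ
    | mul y z _ _ hy hz => rw [map_mul, hy, hz]
  have h3 := h3 x hJ
  rw [h φ h1] at h3
  exact zero_ne_one h3


theorem up_letters {s k j : ℕ} (h1 : s ≤ j) (h2 : j < s + k) {φ : Br n →* ℕ} (h : φ (σ j) = 0) :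
    φ (up n s k) = 0 := by
  induction k with
  | zero => omega
  | succ k ih =>
    rw [up, map_mul]
    rcases Nat.lt_or_ge j (s + k) with h3 | h3
    · rw [ih h3, zero_mul]
    · obtain rfl : j = s + k := by omega
      rw [h, mul_zero]

theorem mem_supp_altProd {s h r : ℕ} (hn : s + h + r + 2 = n) (j : Fin n) :
    ∃ e < 2, j ∈ supp (CoxeterMatrix.A n) (altProd (gapGen n s (h + 1)) e (s + 1 + r)) := by
  have key : ∀ i < s + 1 + r, (∀ φ : Br n →* ℕ, φ (τ j) = 0 → φ (gapGen n s (h + 1) i) = 0) →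
      ∃ e < 2, j ∈ supp (CoxeterMatrix.A n) (altProd (gapGen n s (h + 1)) e (s + 1 + r)) := by
    intro i hi hφ
    refine ⟨i % 2, by omega, mem_supp fun φ h0 => ?_⟩
    obtain ⟨w, hw⟩ := gapGen_dvd_altProd (n := n) (s := s) (h := h + 1) hi rfl
    rw [hw, map_mul, hφ φ h0, zero_mul]
  have hj := j.2
  rcases Nat.lt_or_ge j s with h1 | h1
  · exact key j (by omega) fun φ h0 => by rwa [gapGen_of_lt h1, gen_val]
  · rcases Nat.lt_or_ge (s + h + 1) j with h2 | h2
    · refine key (j - (h + 1)) (by omega) fun φ h0 => ?_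
      rwa [gapGen_of_gt (by omega), show (j : ℕ) - (h + 1) + (h + 1) = j by omega, gen_val]
    · refine key s (by omega) fun φ h0 => ?_
      rw [gapGen_self, cross, map_mul, up_letters h1 (by omega) (by rwa [gen_val]), zero_mul]

/-! ### Square free lifts of transpositions and of longest elements -/

theorem simpleA_succ (k : ℕ) : simpleA n (k + 1) = toCoxeter _ (σ k) := by
  unfold simpleA gen
  by_cases hk : k < n
  · rw [dif_pos (by omega), dif_pos hk]
    rfl
  · rw [dif_neg (by omega), dif_neg hk, map_one]

theorem toCoxeter_up (s k : ℕ) :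
    toCoxeter _ (up n s k) = ((List.Ico (s + 1) (s + 1 + k)).map (simpleA n)).prod := by
  induction k with
  | zero => simp [up]
  | succ k ih =>
    rw [← add_assoc, List.Ico.succ_top (by omega), List.map_append, List.prod_append, ← ih, up,
      map_mul, show s + 1 + k = s + k + 1 by omega]
    simp [simpleA_succ]

theorem toCoxeter_dn (s k : ℕ) :
    toCoxeter _ (dn n s k) = (toCoxeter _ (up n s k))⁻¹ := by
  have hinv : ∀ i, (toCoxeter _ (σ i))⁻¹ = toCoxeter _ (σ i) := by
    intro i
    unfold gen
    split_ifs
    · rw [toCoxeter_T, ← CoxeterMatrix.toCoxeterSystem_simple, CoxeterSystem.inv_simple]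
    · simp
  induction k with
  | zero => simp [up, dn]
  | succ k ih => rw [up, dn, map_mul, map_mul, mul_inv_rev, ih, hinv]

theorem liftTransposition_eq {s g : ℕ} (hn : s + g < n) :
    liftTransposition n (s + 1) (s + g + 1 + 1) = cross n s g := by
  have hs : SqF (cross n s g) := by
    have hd : ∀ x : Br n, x ∣ Δ → SqF x := fun x hx => halfTwist_squareFree.of_dvd hx
    rcases Nat.eq_zero_or_pos g with rfl | hg
    · simp only [cross, up, dn, one_mul, mul_one]
      exact hd _ (gen_dvd_halfTwist (by omega) (by omega) (by omega))
    · obtain ⟨h, rfl⟩ : ∃ h, g = h + 1 := ⟨g - 1, by omega⟩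
      have := hd (halfTwist n s (h + 2)) (halfTwist_dvd (by omega) fun i _ _ =>
        gen_dvd_halfTwist (by omega) (by omega) (by omega))
      rw [← halfTwist_mul_cross (by omega)] at this
      exact this.of_mul.2
  have ht : transposition n (s + 1) (s + g + 1 + 1) = toCoxeter _ (cross n s g) := by
    rw [transposition, cross, up, map_mul, map_mul, toCoxeter_dn, toCoxeter_up,
      Nat.add_sub_cancel, simpleA_succ, show s + g + 1 = s + 1 + g by omega]
  rw [liftTransposition, if_pos (by omega), ht, sqfLift_toCoxeter hs]

theorem liftLongestInterval_eq {s k : ℕ} (hn : s + k ≤ n) :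
    liftLongestInterval n (s + 1) (s + k) = halfTwist n s k := by
  have hs : SqF (halfTwist n s k) := halfTwist_squareFree.of_dvd (halfTwist_dvd hn fun i _ _ =>
    gen_dvd_halfTwist (by omega) (by omega) (by omega))
  rw [liftLongestInterval, longest_eq hs, sqfLift_toCoxeter hs]
  · refine Submonoid.closure_mono (t := T (CoxeterMatrix.A n) '' _) ?_ (halfTwist_mem s k)
    rintro _ ⟨i, ⟨h1, h2⟩, rfl⟩
    refine ⟨⟨i, by omega⟩, ⟨?_, ?_⟩, (gen_of_lt _).symm⟩
    · simpa using h1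
    · dsimp only
      omega
  · rintro j ⟨h1, h2⟩
    rw [← gen_val]
    exact gen_dvd_halfTwist (by omega) (by omega) hn

/-! ### The set with a gap -/

theorem mem_gapSet {s h q : ℕ} : q ∈ gapSet n (s + 1) (s + h + 2) ↔
    1 ≤ q ∧ q ≤ s + 1 ∨ s + h + 3 ≤ q ∧ q ≤ n + 1 := by
  simp only [gapSet, Finset.mem_union, Finset.mem_Icc]

theorem card_gapSet {s h r : ℕ} (hn : s + h + r + 2 = n) :
    (gapSet n (s + 1) (s + h + 2)).card = s + r + 2 := by
  rw [gapSet, Finset.card_union_of_disjoint, Nat.card_Icc, Nat.card_Icc]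
  · omega
  · rw [Finset.disjoint_left]
    intro q h1 h2
    rw [Finset.mem_Icc] at h1 h2
    omega

theorem mOf_gapSet {s h r : ℕ} (hn : s + h + r + 2 = n) :
    mOf n (gapSet n (s + 1) (s + h + 2)) = halfEntry s r := by
  have hiff : (gapSet n (s + 1) (s + h + 2)).image (fun j => n + 2 - j) =
      gapSet n (s + 1) (s + h + 2) ↔ s = r := by
    constructor
    · intro he
      have h1 : ∀ q ∈ gapSet n (s + 1) (s + h + 2), n + 2 - q ∈ gapSet n (s + 1) (s + h + 2) := by
        intro q hq
        rw [← he]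
        exact Finset.mem_image_of_mem _ hq
      rcases lt_trichotomy s r with hlt | heq | hlt
      · have h2 := h1 (h + r + 2) (mem_gapSet.2 (by omega))
        rw [mem_gapSet] at h2
        omega
      · exact heq
      · have h2 := h1 (r + 2) (mem_gapSet.2 (by omega))
        rw [mem_gapSet] at h2
        omega
    · rintro rfl
      ext q
      rw [Finset.mem_image]
      constructor
      · rintro ⟨j, hj, rfl⟩
        rw [mem_gapSet] at hj ⊢
        omega
      · intro hq
        rw [mem_gapSet] at hq
        exact ⟨n + 2 - q, mem_gapSet.2 (by omega), by omega⟩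
  unfold mOf halfEntry
  rw [card_gapSet hn]
  by_cases hsr : s = r
  · rw [if_pos (hiff.2 hsr), if_pos hsr]
    omega
  · rw [if_neg (fun he => hsr (hiff.1 he)), if_neg hsr]

/-- The strands of `Nat`-index `pos s (h + 1) q` are the elements of the set with a gap, which is
numbered from `1`, in increasing order. -/
theorem nth_gapSet {s h r q : ℕ} (hn : s + h + r + 2 = n) (hq : q < s + r + 2) :
    Nat.nth (· ∈ gapSet n (s + 1) (s + h + 2)) q = pos s (h + 1) q + 1 := by
  have hcount : ∀ q, q < s + r + 2 →
      Nat.count (· ∈ gapSet n (s + 1) (s + h + 2)) (pos s (h + 1) q + 1) = q := by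
    intro q hq
    rw [Nat.count_eq_card_filter_range]
    have : (Finset.range (pos s (h + 1) q + 1)).filter (· ∈ gapSet n (s + 1) (s + h + 2)) =
        (Finset.range q).image fun i => pos s (h + 1) i + 1 := by
      ext j
      simp only [Finset.mem_filter, Finset.mem_range, Finset.mem_image, mem_gapSet]
      constructor
      · rintro ⟨h1, h2⟩
        rcases h2 with h2 | h2
        · refine ⟨j - 1, ?_, ?_⟩ <;> unfold pos at * <;> split_ifs at * <;> omega
        · refine ⟨j - 1 - (h + 1), ?_, ?_⟩ <;> unfold pos at * <;> split_ifs at * <;> omega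
      · rintro ⟨i, hi, rfl⟩
        unfold pos
        split_ifs <;> omega
    rw [this, Finset.card_image_of_injective, Finset.card_range]
    exact fun i j hij => pos_injective s (h + 1) (Nat.succ_injective hij)
  have hmem : pos s (h + 1) q + 1 ∈ gapSet n (s + 1) (s + h + 2) := by
    rw [mem_gapSet]
    unfold pos
    split_ifs <;> omega
  have := Nat.nth_count (p := (· ∈ gapSet n (s + 1) (s + h + 2))) hmem
  rwa [hcount q hq] at this

theorem tauTilde_eq {s h r : ℕ} (hn : s + h + r + 2 = n) {e k : ℕ} (he : e + k = 1) :
    tauTilde n (gapSet n (s + 1) (s + h + 2)) k =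
      altProd (gapGen n s (h + 1)) e (s + 1 + r) := by
  have hfac : ∀ m < s + 1 + r, liftTransposition n
      (Nat.nth (· ∈ gapSet n (s + 1) (s + h + 2)) (m + 1 - 1))
      (Nat.nth (· ∈ gapSet n (s + 1) (s + h + 2)) (m + 1)) = gapGen n s (h + 1) m := by
    intro m hm
    rw [Nat.add_sub_cancel, nth_gapSet hn (by omega), nth_gapSet hn (by omega)]
    rcases lt_trichotomy m s with h1 | rfl | h1
    · rw [gapGen_of_lt h1, pos, pos, if_pos h1.le, if_pos (Nat.succ_le_of_lt h1)]
      have := liftTransposition_eq (n := n) (s := m) (g := 0) (by omega)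
      simpa [cross, up, dn] using this
    · rw [gapGen_self, pos, pos, if_pos le_rfl, if_neg (by omega),
        ← liftTransposition_eq (by omega)]
      congr 1
      omega
    · rw [gapGen_of_gt h1, pos, pos, if_neg (by omega), if_neg (by omega)]
      have := liftTransposition_eq (n := n) (s := m + (h + 1)) (g := 0) (by omega)
      rw [show m + 1 + (h + 1) + 1 = m + (h + 1) + 0 + 1 + 1 by omega, this]
      simp [cross, up, dn]
  have hpart : ∀ m ≤ s + 1 + r, (((List.Ico 1 (m + 1)).filter (fun r => r % 2 = k)).map
      (fun r => liftTransposition n (Nat.nth (· ∈ gapSet n (s + 1) (s + h + 2)) (r - 1))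
        (Nat.nth (· ∈ gapSet n (s + 1) (s + h + 2)) r))).prod =
      altProd (gapGen n s (h + 1)) e m := by
    intro m hm
    induction m with
    | zero => simp [altProd]
    | succ m ih =>
      rw [List.Ico.succ_top (by omega), List.filter_append, List.map_append, List.prod_append,
        ih (by omega), altProd]
      congr 1
      by_cases hme : m % 2 = e
      · have hk : (m + 1) % 2 = k := by omega
        rw [if_pos hme, List.filter_cons_of_pos (by simpa using hk), List.filter_nil,
          List.map_singleton, List.prod_singleton, hfac m (by omega)]
      · have hk : ¬ (m + 1) % 2 = k := by omega
        rw [if_neg hme, List.filter_cons_of_neg (by simpa using hk), List.filter_nil,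
          List.map_nil, List.prod_nil]
  rw [tauTilde, card_gapSet hn, show s + r + 2 = s + 1 + r + 1 by omega]
  exact hpart _ le_rfl

end Translation

/-! ### The homomorphism from the dihedral Artin monoid -/

section Hom

variable {n s h r : ℕ}

local notation "τ" => T (CoxeterMatrix.A n)
local notation "D" => dihedral (2 * halfEntry s r)
local notation "Δ" => halfTwist n 0 n
local notation "𝐀" => altProd (gapGen n s (h + 1)) 0 (s + 1 + r)
local notation "𝐁" => altProd (gapGen n s (h + 1)) 1 (s + 1 + r)
local notation "𝐆" => halfTwist n (s + 1) h

theorem halfEntry_pos (s r : ℕ) : 0 < halfEntry s r := by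
  unfold halfEntry
  split_ifs <;> omega

theorem exists_dihedral_hom (hn : s + h + r + 2 = n) :
    ∃ Φ : ArtinMonoid D →* Br n, Φ (T D 0) = 𝐀 ∧ Φ (T D 1) = 𝐁 := by
  have hm := (mem_braidSet_halfEntry hn).2
  let f : Fin 2 → Br n := ![𝐀, 𝐁]
  refine ⟨PresentedMonoid.lift f ?_, rfl, rfl⟩
  rintro _ _ ⟨i, j, hij, h0, rfl, rfl⟩
  rw [map_brd, map_brd, dihedral_apply (halfEntry_pos s r) hij]
  simp only [FreeMonoid.lift_eval_of]
  fin_cases i <;> fin_cases j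
  · exact absurd rfl hij
  · exact hm
  · exact hm.symm
  · exact absurd rfl hij

theorem isOptimal_of_apply (hn : s + h + r + 2 = n) {Φ : ArtinMonoid D →* Br n}
    (h0 : Φ (T D 0) = 𝐀) (h1 : Φ (T D 1) = 𝐁) : IsOptimal Φ := by
  have hl := isLeast_braidSet hn
  intro i j hne _
  have hij : i ≠ j := fun e => hne (e ▸ rfl)
  rw [dihedral_apply (halfEntry_pos s r) hij]
  fin_cases i <;> fin_cases j
  · exact absurd rfl hij
  · change IsLeast (braidSet (Φ (T D 0)) (Φ (T D 1))) _
    rwa [h0, h1]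
  · change IsLeast (braidSet (Φ (T D 1)) (Φ (T D 0))) _
    rwa [h0, h1, braidSet_comm]
  · exact absurd rfl hij

theorem toCoxeter_altProd_sq (hn : s + h + r + 2 = n) (e m : ℕ) (hm : m ≤ s + 1 + r) :
    toCoxeter _ (altProd (gapGen n s (h + 1)) e m) *
      toCoxeter _ (altProd (gapGen n s (h + 1)) e m) = 1 := by
  induction m with
  | zero => simp [altProd]
  | succ m ih =>
    rw [altProd]
    split_ifs with hme
    · have hp : pos s (h + 1) m < n := by unfold pos; split_ifs <;> omega
      have hx : toCoxeter _ (gapGen n s (h + 1) m) * toCoxeter _ (gapGen n s (h + 1) m) = 1 := by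
        refine permHom_injective ?_
        rw [map_mul, ← perm_eq, perm_gapGen (by omega) hp, Equiv.swap_mul_self, map_one]
      have hc : Commute (altProd (gapGen n s (h + 1)) e m) (gapGen n s (h + 1) m) :=
        (commute_altProd fun i _ _ => (gapGen_commute (by omega)).symm).symm
      have hc' := (hc.map (toCoxeter (CoxeterMatrix.A n))).eq
      rw [map_mul, mul_assoc, ← mul_assoc (toCoxeter _ (gapGen n s (h + 1) m)), ← hc',
        mul_assoc, hx, mul_one, ih (by omega)]
    · rw [mul_one]
      exact ih (by omega)

/-- For involutions a braid relation is a relation on the order of the product. -/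
theorem mul_pow_eq_one_of_brd {G : Type*} [Group G] {a b : G} (ha : a * a = 1) (hb : b * b = 1)
    {m : ℕ} (h : brd a b (2 * m) = brd b a (2 * m)) : (a * b) ^ (2 * m) = 1 := by
  have hinv : b * a = (a * b)⁻¹ := by
    rw [mul_inv_rev, inv_eq_of_mul_eq_one_left ha, inv_eq_of_mul_eq_one_left hb]
  rw [brd_two_mul, brd_two_mul, hinv, inv_pow] at h
  rw [two_mul, pow_add]
  nth_rewrite 1 [h]
  rw [inv_mul_cancel]

theorem isCoxeterType_of_apply (hn : s + h + r + 2 = n) {Φ : ArtinMonoid D →* Br n}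
    (h0 : Φ (T D 0) = 𝐀) (h1 : Φ (T D 1) = 𝐁) : IsCoxeterType Φ := by
  have hsq : ∀ i : Fin 2, toCoxeter _ (Φ (T D i)) * toCoxeter _ (Φ (T D i)) = 1 := by
    intro i
    fin_cases i
    · change toCoxeter _ (Φ (T D 0)) * toCoxeter _ (Φ (T D 0)) = 1
      rw [h0]
      exact toCoxeter_altProd_sq hn 0 _ le_rfl
    · change toCoxeter _ (Φ (T D 1)) * toCoxeter _ (Φ (T D 1)) = 1
      rw [h1]
      exact toCoxeter_altProd_sq hn 1 _ le_rfl
  have hl : (dihedral (2 * halfEntry s r)).IsLiftable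
      (fun i => toCoxeter (CoxeterMatrix.A n) (Φ (T D i))) := by
    intro i j
    by_cases hij : i = j
    · subst hij
      rw [hsq, one_pow]
    · rw [dihedral_apply (halfEntry_pos s r) hij]
      refine mul_pow_eq_one_of_brd (hsq i) (hsq j) ?_
      rw [← map_brd, ← map_brd, ← map_brd, ← map_brd, brd_T_dihedral (halfEntry_pos s r) hij]
  refine ⟨(dihedral (2 * halfEntry s r)).toCoxeterSystem.lift ⟨_, hl⟩, fun x => ?_⟩
  induction x using artin_induction with
  | one => simp
  | mul i x ih =>
    rw [map_mul, map_mul, ih, map_mul, map_mul, toCoxeter_T,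
      ← CoxeterMatrix.toCoxeterSystem_simple, CoxeterSystem.lift_apply_simple]

theorem isParabolic_of_apply (hn : s + h + r + 2 = n) {Φ : ArtinMonoid D →* Br n}
    (h0 : Φ (T D 0) = 𝐀) (h1 : Φ (T D 1) = 𝐁) : IsParabolic Φ := by
  intro J hJ
  have hm := halfEntry_pos s r
  obtain rfl : J = Set.univ :=
    Set.eq_univ_of_univ_subset (hJ.2 (isFiniteType_univ hm) (Set.subset_univ J))
  have hsupp : suppMap Φ Set.univ = Set.univ := by
    refine Set.eq_univ_of_forall fun j => ?_
    obtain ⟨e, he, hj⟩ := mem_supp_altProd hn j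
    simp only [suppMap, Set.mem_iUnion]
    rcases Nat.eq_zero_or_pos e with rfl | he0
    · exact ⟨0, trivial, by rwa [h0]⟩
    · obtain rfl : e = 1 := by omega
      exact ⟨1, trivial, by rwa [h1]⟩
  rw [hsupp, Submonoid.map_le_iff_le_comap, parabolicElements, Submonoid.closure_le]
  rintro _ ⟨C, K, hC, hK, rfl⟩
  rw [SetLike.mem_coe, Submonoid.mem_comap]
  obtain ⟨i, j, hij, he⟩ := exists_eq_brd (sqfLift_squareFree (longest D K * longest D C))
  obtain ⟨p1, p2, p3⟩ := brd_mem_parabolicElements hn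
  have p4 := p1
  rw [(mem_braidSet_halfEntry hn).2] at p4
  have hcase : i = 0 ∧ j = 1 ∨ i = 1 ∧ j = 0 := by omega
  rw [he, map_brd]
  rcases len_parabolic hm hC hK with hl | hl | hl <;> rw [hl] <;>
    rcases hcase with ⟨rfl, rfl⟩ | ⟨rfl, rfl⟩ <;> rw [h0, h1]
  · rw [brd_zero]; exact one_mem _
  · rw [brd_zero]; exact one_mem _
  · exact p2
  · exact p3
  · exact p1
  · exact p4

end Hom

end ArtinHom

theorem mainTheorem5 (n a b : ℕ) (ha : 1 ≤ a) (hab : a < b) (hbn : b ≤ n) :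
    (∃ Φ : ArtinHom.ArtinMonoid (ArtinHom.dihedral (2 * ArtinHom.mOf n (ArtinHom.gapSet n a b))) →*
        ArtinHom.ArtinMonoid (CoxeterMatrix.A n),
      Φ (ArtinHom.T _ 0) = ArtinHom.tauTilde n (ArtinHom.gapSet n a b) 1 ∧
      Φ (ArtinHom.T _ 1) = ArtinHom.tauTilde n (ArtinHom.gapSet n a b) 0 ∧
      ArtinHom.IsOptimal Φ ∧ ArtinHom.IsParabolic Φ ∧ ArtinHom.IsCoxeterType Φ) ∧
    ArtinHom.toGroup (CoxeterMatrix.A n) (ArtinHom.TJ n (ArtinHom.gapSet n a b)) ^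
        (ArtinHom.gapSet n a b).card =
      ArtinHom.toGroup (CoxeterMatrix.A n) (ArtinHom.liftLongestInterval n 1 n) ^ 2 *
        (ArtinHom.toGroup (CoxeterMatrix.A n)
          (ArtinHom.liftLongestInterval n (a + 1) (b - 1)) ^ 2)⁻¹ := by
  obtain ⟨s, rfl⟩ : ∃ s, a = s + 1 := ⟨a - 1, by omega⟩
  obtain ⟨h, rfl⟩ : ∃ h, b = s + h + 2 := ⟨b - (s + 2), by omega⟩
  obtain ⟨r, hr⟩ : ∃ r, s + h + r + 2 = n := ⟨n - (s + h + 2), by omega⟩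
  have e1 := ArtinHom.tauTilde_eq hr (e := 0) (k := 1) rfl
  have e0 := ArtinHom.tauTilde_eq hr (e := 1) (k := 0) rfl
  rw [ArtinHom.mOf_gapSet hr, ArtinHom.TJ, e1, e0, ArtinHom.card_gapSet hr]
  constructor
  · obtain ⟨Φ, h0, h1⟩ := ArtinHom.exists_dihedral_hom hr
    exact ⟨Φ, h0, h1, ArtinHom.isOptimal_of_apply hr h0 h1, ArtinHom.isParabolic_of_apply hr h0 h1,
      ArtinHom.isCoxeterType_of_apply hr h0 h1⟩
  · have hfull := ArtinHom.liftLongestInterval_eq (n := n) (s := 0) (k := n) (by omega)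
    have hgap := ArtinHom.liftLongestInterval_eq (n := n) (s := s + 1) (k := h) (by omega)
    rw [zero_add, zero_add] at hfull
    rw [hfull, show s + h + 2 - 1 = s + 1 + h by omega, hgap, eq_mul_inv_iff_mul_eq, ← map_pow,
      ← map_pow, ← map_pow, ← map_mul, ← ArtinHom.halfTwist_sq_mul_bipartite_pow hr]
    congr 1
    exact ((((ArtinHom.halfTwist_commute_altProd hr 0 _).mul_right
      (ArtinHom.halfTwist_commute_altProd hr 1 _)).pow_left 2).pow_right _).symm.eq
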